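/- **Conventions.** An étale groupoid $\mathcal G$ over a space $X$ is a topological groupoid with unit space $X$ (with the topology induced from $\mathcal G$) whose source and range maps $s,r:\mathcal G\to X$ are local homeomorphisms; $\mathcal G$ need not be Hausdorff. A *bisection* is an open set $T\subset\mathcal G$ on which $s$ and $r$ are homeomorphisms onto their images; it induces a homeomorphism $\tau(T)=r|_T\circ (s|_T)^{-1}: s(T)\to r(T)$. $\mathcal G$ is *effective* if every bisection $T$ is determined by $\tau(T)$, *minimal* if every orbit $r(s^{-1}(x))$ is dense in $X$, and *compactly generated* if there is a compact $K\subset\mathcal G$ such that every element of $\mathcal G$ is a product of elements of $K\cup K^{-1}$. The *full group* $\mathsf F(\mathcal G)$ is the group of bisections $g$ with $s(g)=r(g)=X$, under $TS=\{\gamma\delta:\gamma\in T,\ \delta\in S,\ s(\gamma)=r(\delta)\}$. A *multisection* of degree $d$ is a family of bisections $(F(i,j))_{1\le i,j\le d}$ such that the $F(i,i)$ are pairwise disjoint compact open subsets of $X$ and $F(i,j)F(j,l)=F(i,l)$; for a permutation $\sigma$ of $\{1,\dots,d\}$ put $F(\sigma)=\bigcup_i F(\sigma(i),i)\ \sqcup\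 (X\setminus\bigcup_i F(i,i))\in\mathsf F(\mathcal G)$. The *alternating full group* $\mathsf A(\mathcal G)\le \mathsf F(\mathcal G)$ is generated by all $F(\sigma)$ with $F$ a multisection of degree $d\ge 3$ and $\sigma$ even. A *finite generating set* $\mathcal T$ of $\mathcal G$ is here a finite set of compact open bisections, closed under $T\mapsto T^{-1}$, such that $\mathcal G$ is covered by the finite products of members of $\mathcal T$ (the empty product being $X$). For $x\in X$ let $\Gamma_x$ be the orbit of $x$, with the graph in which $y$ and $\tau(T)(y)$ are joined by an edge ($T\in\mathcal T$, $y\in s(T)$), and let $\beta_{\mathcal G}(n)=\max_{x\in X}|B_{\Gamma_x}(x,n)|$, where $B$ denotes closed balls for the graph distance. For functions $f,g$ on $\mathbb N$ write $f\preceq g$ if there is an integer $C>0$ with $f(n)\le C\,g(Cn)$ for all $n$, and $f\sim g$ if $f\preceq g\preceq f$. For a metric space $\Gamma$ put $\overline b_\Gamma(n)=\sup_{v\in\Gamma}|B_\Gamma(v,n)|$; $\Gamma$ has *bounded geometry* if $\overline b_\Gamma(n)<\infty$ for all $n$. $W(\Gamma)$ is the group of permutations $\sigma$ of $\Gamma$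 with $\sup_v d(v,\sigma(v))<\infty$. A group $A$ has *property $\mathrm{FG}_f$* if, for every metric space $\Gamma$ of bounded geometry with $f\not\preceq\overline b_\Gamma$, every homomorphism $A\to W(\Gamma)$ has finite image. **Theorem.** Let $\mathcal G$ be a compactly generated, minimal, effective étale groupoid over a Cantor space $X$. Then $\mathcal G$ has a finite generating set $\mathcal T$ as above, and for every such $\mathcal T$, with $\beta_{\mathcal G}$ and the graphs $\Gamma_x$ defined by $\mathcal T$: 1. $n\preceq\beta_{\mathcal G}(n)\preceq\exp(n)$. 2. $\mathsf A(\mathcal G)$ has property $\mathrm{FG}_{\beta_{\mathcal G}}$; moreover, if $\Gamma$ is a metric space of bounded geometry with $\beta_{\mathcal G}\not\preceq\overline b_\Gamma$, then every homomorphism $\mathsf A(\mathcal G)\to W(\Gamma)$ is trivial. 3. The function $\beta_{\mathcal G}$ is sharp. For every $x\in X$ the graph $\Gamma_x$ is connected, has bounded geometry and satisfies $\overline b_{\Gamma_x}\sim\beta_{\mathcal G}$, and the natural action of $\mathsf F(\mathcal G)$ on the orbit of $x$, $g\cdot y=\tau(g)(y)$, is an injective homomorphism $\mathsf F(\mathcal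 G)\to W(\Gamma_x)$. Consequently, if $\mathsf A(\mathcal G)$ has property $\mathrm{FG}_f$ for a function $f:\mathbb N\to\mathbb N\cup\{\infty\}$, then $f\preceq\beta_{\mathcal G}$. -/

import Mathlib

open Set Topology

universe u v w

/-- The vertex set of a connected graph as a metric space, with the graph distance. -/
@[reducible]
noncomputable def graphMetricSpace {V : Type u} {G : SimpleGraph V} (hG : G.Connected) :
    MetricSpace V where
  dist y z := (G.dist y z : ℝ)
  dist_self y := by simp
  dist_comm y z := by rw [SimpleGraph.dist_comm]
  dist_triangle y z t := by exact_mod_cast hG.dist_triangle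
  eq_of_dist_eq_zero h := hG.dist_eq_zero_iff.1 (by exact_mod_cast h)

/-! ## Étale groupoids -/

/-- An étale groupoid with unit space `X` and space of arrows `𝒢`: a small groupoid in which every
arrow `γ` has a source `src γ` and a range `rng γ`, in which `γ δ` is defined iff
`src γ = rng δ`, and whose source and range maps are local homeomorphisms.
The space of arrows need not be Hausdorff. -/
structure EtaleGroupoid (X : Type u) (𝒢 : Type v) [TopologicalSpace X] [TopologicalSpace 𝒢] where
  src : 𝒢 → X
  rng : 𝒢 → X
  /-- the identity arrow of a unit -/
  one : X → 𝒢
  inv : 𝒢 → 𝒢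
  /-- the product, defined on the space of composable pairs -/
  mul : {p : 𝒢 × 𝒢 // src p.1 = rng p.2} → 𝒢
  src_one : ∀ x, src (one x) = x
  rng_one : ∀ x, rng (one x) = x
  src_inv : ∀ a, src (inv a) = rng a
  rng_inv : ∀ a, rng (inv a) = src a
  src_mul : ∀ p, src (mul p) = src p.1.2
  rng_mul : ∀ p, rng (mul p) = rng p.1.1
  one_mul : ∀ a, mul ⟨(one (rng a), a), src_one _⟩ = a
  mul_one : ∀ a, mul ⟨(a, one (src a)), (rng_one _).symm⟩ = a
  inv_mul : ∀ a, mul ⟨(inv a, a), src_inv a⟩ = one (src a)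
  mul_inv : ∀ a, mul ⟨(a, inv a), (rng_inv a).symm⟩ = one (rng a)
  mul_assoc : ∀ (a b c : 𝒢) (hab : src a = rng b) (hbc : src b = rng c),
    mul ⟨(mul ⟨(a, b), hab⟩, c), (src_mul ⟨(a, b), hab⟩).trans hbc⟩ =
      mul ⟨(a, mul ⟨(b, c), hbc⟩), hab.trans (rng_mul ⟨(b, c), hbc⟩).symm⟩
  isEmbedding_one : IsEmbedding one
  continuous_inv : Continuous inv
  continuous_mul : Continuous mul
  isLocalHomeomorph_src : IsLocalHomeomorph src
  isLocalHomeomorph_rng : IsLocalHomeomorph rng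

namespace EtaleGroupoid

variable {X : Type u} {𝒢 : Type v} [TopologicalSpace X] [TopologicalSpace 𝒢]

/-- The orbit of a unit. -/
def orbit (𝓖 : EtaleGroupoid X 𝒢) (x : X) : Set X := {y | ∃ γ, 𝓖.src γ = x ∧ 𝓖.rng γ = y}

/-- Every orbit is dense in the unit space. -/
def IsMinimal (𝓖 : EtaleGroupoid X 𝒢) : Prop := ∀ x, Dense (𝓖.orbit x)

/-! ### Bisections -/

/-- A bisection: an open set of arrows on which source and range are homeomorphisms onto their
images. -/
structure IsBisection (𝓖 : EtaleGroupoid X 𝒢) (T : Set 𝒢) : Prop where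
  isOpen : IsOpen T
  isEmbedding_src : IsEmbedding (T.domRestrict 𝓖.src)
  isEmbedding_rng : IsEmbedding (T.domRestrict 𝓖.rng)

/-- The set `X` of units, as a set of arrows. -/
def unitSet (𝓖 : EtaleGroupoid X 𝒢) : Set 𝒢 := range 𝓖.one

/-- The product `T S = {γ δ : γ ∈ T, δ ∈ S, src γ = rng δ}`. -/
def setMul (𝓖 : EtaleGroupoid X 𝒢) (T S : Set 𝒢) : Set 𝒢 :=
  {α | ∃ p : {p : 𝒢 × 𝒢 // 𝓖.src p.1 = 𝓖.rng p.2}, p.1.1 ∈ T ∧ p.1.2 ∈ S ∧ 𝓖.mul p = α}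

/-- The inverse `T⁻¹ = {γ⁻¹ : γ ∈ T}`. -/
def setInv (𝓖 : EtaleGroupoid X 𝒢) (T : Set 𝒢) : Set 𝒢 := 𝓖.inv '' T

/-- The product `T₁ T₂ ⋯ Tₙ` of a finite list of sets of arrows; the empty product is `X`. -/
def listProd (𝓖 : EtaleGroupoid X 𝒢) (l : List (Set 𝒢)) : Set 𝒢 := l.foldr 𝓖.setMul 𝓖.unitSet

/-- The graph of `τ(T) : src(T) → rng(T)`, which sends `src γ` to `rng γ` for `γ ∈ T`. -/
def tauGraph (𝓖 : EtaleGroupoid X 𝒢) (T : Set 𝒢) : Set (X × X) :=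
  (fun γ => (𝓖.src γ, 𝓖.rng γ)) '' T

/-- Effective groupoids (groupoids of germs): every bisection `T` is determined by the partial
homeomorphism `τ(T)`. -/
def IsEffective (𝓖 : EtaleGroupoid X 𝒢) : Prop :=
  ∀ T S, 𝓖.IsBisection T → 𝓖.IsBisection S → 𝓖.tauGraph T = 𝓖.tauGraph S → T = S

/-! ### Algebra of bisections -/

theorem inv_inv (𝓖 : EtaleGroupoid X 𝒢) (a : 𝒢) : 𝓖.inv (𝓖.inv a) = a := by
  have key := 𝓖.mul_assoc (𝓖.inv (𝓖.inv a)) (𝓖.inv a) a (𝓖.src_inv _) (𝓖.src_inv _)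
  have h1 : 𝓖.mul ⟨(𝓖.mul ⟨(𝓖.inv (𝓖.inv a), 𝓖.inv a), 𝓖.src_inv _⟩, a),
      (𝓖.src_mul _).trans (𝓖.src_inv _)⟩ = a := by
    refine Eq.trans ?_ (𝓖.one_mul a)
    congr 1
    apply Subtype.ext
    refine Prod.ext ?_ rfl
    exact (𝓖.inv_mul _).trans (congrArg _ (𝓖.src_inv _))
  have h2 : 𝓖.mul ⟨(𝓖.inv (𝓖.inv a), 𝓖.mul ⟨(𝓖.inv a, a), 𝓖.src_inv _⟩),
      (𝓖.src_inv _).trans (𝓖.rng_mul ⟨(𝓖.inv a, a), 𝓖.src_inv a⟩).symm⟩ = 𝓖.inv (𝓖.inv a) := by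
    refine Eq.trans ?_ (𝓖.mul_one (𝓖.inv (𝓖.inv a)))
    congr 1
    apply Subtype.ext
    refine Prod.ext rfl ?_
    refine (𝓖.inv_mul _).trans (congrArg _ ?_)
    rw [𝓖.src_inv, 𝓖.rng_inv]
  exact (h1.symm.trans (key.trans h2)).symm

theorem setInv_eq_preimage (𝓖 : EtaleGroupoid X 𝒢) (T : Set 𝒢) :
    𝓖.setInv T = 𝓖.inv ⁻¹' T := by
  ext γ
  constructor
  · rintro ⟨δ, hδ, rfl⟩
    simpa [𝓖.inv_inv] using hδ
  · intro h
    exact ⟨_, h, 𝓖.inv_inv γ⟩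

theorem isBisection_iff (𝓖 : EtaleGroupoid X 𝒢) (T : Set 𝒢) :
    𝓖.IsBisection T ↔ IsOpen T ∧ InjOn 𝓖.src T ∧ InjOn 𝓖.rng T := by
  constructor
  · intro h
    exact ⟨h.isOpen, injOn_iff_injective.2 h.isEmbedding_src.injective,
      injOn_iff_injective.2 h.isEmbedding_rng.injective⟩
  · rintro ⟨ho, hs, hr⟩
    refine ⟨ho, ?_, ?_⟩
    · exact (IsOpenEmbedding.of_continuous_injective_isOpenMap
        (𝓖.isLocalHomeomorph_src.continuous.comp continuous_subtype_val)
        (injOn_iff_injective.1 hs)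
        (𝓖.isLocalHomeomorph_src.isOpenMap.comp ho.isOpenMap_subtype_val)).isEmbedding
    · exact (IsOpenEmbedding.of_continuous_injective_isOpenMap
        (𝓖.isLocalHomeomorph_rng.continuous.comp continuous_subtype_val)
        (injOn_iff_injective.1 hr)
        (𝓖.isLocalHomeomorph_rng.isOpenMap.comp ho.isOpenMap_subtype_val)).isEmbedding

theorem mul_congr (𝓖 : EtaleGroupoid X 𝒢) {a a' b b' : 𝒢} (h : 𝓖.src a = 𝓖.rng b)
    (ha : a = a') (hb : b = b') (h' : 𝓖.src a' = 𝓖.rng b') :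
    𝓖.mul ⟨(a, b), h⟩ = 𝓖.mul ⟨(a', b'), h'⟩ := by
  subst ha hb; rfl

theorem inv_mul_cancel_left (𝓖 : EtaleGroupoid X 𝒢) (a b : 𝒢) (h : 𝓖.src a = 𝓖.rng b)
    (h' : 𝓖.src (𝓖.inv a) = 𝓖.rng (𝓖.mul ⟨(a, b), h⟩)) :
    𝓖.mul ⟨(𝓖.inv a, 𝓖.mul ⟨(a, b), h⟩), h'⟩ = b := by
  have h1 := 𝓖.mul_assoc (𝓖.inv a) a b (𝓖.src_inv a) h
  rw [← h1, 𝓖.mul_congr _ ((𝓖.inv_mul a).trans (congrArg 𝓖.one h)) rfl (𝓖.src_one _), 𝓖.one_mul]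

theorem mul_inv_cancel_left (𝓖 : EtaleGroupoid X 𝒢) (a b : 𝒢) (h : 𝓖.src (𝓖.inv a) = 𝓖.rng b)
    (h' : 𝓖.src a = 𝓖.rng (𝓖.mul ⟨(𝓖.inv a, b), h⟩)) :
    𝓖.mul ⟨(a, 𝓖.mul ⟨(𝓖.inv a, b), h⟩), h'⟩ = b := by
  have h1 := 𝓖.mul_assoc a (𝓖.inv a) b (𝓖.rng_inv a).symm h
  rw [← h1, 𝓖.mul_congr _ ((𝓖.mul_inv a).trans (congrArg 𝓖.one ((𝓖.src_inv a).symm.trans h))) rfl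
    (𝓖.src_one _), 𝓖.one_mul]

theorem setMul_assoc (𝓖 : EtaleGroupoid X 𝒢) (T S R : Set 𝒢) :
    𝓖.setMul (𝓖.setMul T S) R = 𝓖.setMul T (𝓖.setMul S R) := by
  ext α
  constructor
  · rintro ⟨⟨⟨_, c⟩, h⟩, ⟨⟨⟨a, b⟩, hab⟩, ha, hb, rfl⟩, hc, rfl⟩
    have hbc : 𝓖.src b = 𝓖.rng c := (𝓖.src_mul ⟨(a, b), hab⟩).symm.trans h
    exact ⟨⟨(a, 𝓖.mul ⟨(b, c), hbc⟩), hab.trans (𝓖.rng_mul ⟨(b, c), hbc⟩).symm⟩, ha,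
      ⟨⟨(b, c), hbc⟩, hb, hc, rfl⟩, (𝓖.mul_assoc a b c hab hbc).symm⟩
  · rintro ⟨⟨⟨a, _⟩, h⟩, ha, ⟨⟨⟨b, c⟩, hbc⟩, hb, hc, rfl⟩, rfl⟩
    have hab : 𝓖.src a = 𝓖.rng b := h.trans (𝓖.rng_mul ⟨(b, c), hbc⟩)
    exact ⟨⟨(𝓖.mul ⟨(a, b), hab⟩, c), (𝓖.src_mul _).trans hbc⟩,
      ⟨⟨(a, b), hab⟩, ha, hb, rfl⟩, hc, 𝓖.mul_assoc a b c hab hbc⟩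

theorem unitSet_setMul (𝓖 : EtaleGroupoid X 𝒢) (T : Set 𝒢) : 𝓖.setMul 𝓖.unitSet T = T := by
  ext α
  constructor
  · rintro ⟨⟨⟨_, b⟩, h⟩, ⟨x, rfl⟩, hb, rfl⟩
    have hx : x = 𝓖.rng b := (𝓖.src_one x).symm.trans h
    subst hx
    rw [𝓖.one_mul]
    exact hb
  · intro h
    exact ⟨_, ⟨_, rfl⟩, h, 𝓖.one_mul α⟩

theorem setMul_unitSet (𝓖 : EtaleGroupoid X 𝒢) (T : Set 𝒢) : 𝓖.setMul T 𝓖.unitSet = T := by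
  ext α
  constructor
  · rintro ⟨⟨⟨a, _⟩, h⟩, ha, ⟨x, rfl⟩, rfl⟩
    have hx : x = 𝓖.src a := (𝓖.rng_one x).symm.trans h.symm
    subst hx
    rw [𝓖.mul_one]
    exact ha
  · intro h
    exact ⟨_, h, ⟨_, rfl⟩, 𝓖.mul_one α⟩

theorem isBisection_unitSet (𝓖 : EtaleGroupoid X 𝒢) : 𝓖.IsBisection 𝓖.unitSet := by
  rw [isBisection_iff]
  refine ⟨?_, ?_, ?_⟩
  · have hl : IsLocalHomeomorph 𝓖.one := by
      refine IsLocalHomeomorph.of_comp ?_ 𝓖.isLocalHomeomorph_src 𝓖.isEmbedding_one.continuous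
      have : 𝓖.src ∘ 𝓖.one = id := funext 𝓖.src_one
      rw [this]
      exact (Homeomorph.refl X).isLocalHomeomorph
    exact hl.isOpenMap.isOpen_range
  · rintro _ ⟨x, rfl⟩ _ ⟨y, rfl⟩ h
    rw [𝓖.src_one, 𝓖.src_one] at h
    rw [h]
  · rintro _ ⟨x, rfl⟩ _ ⟨y, rfl⟩ h
    rw [𝓖.rng_one, 𝓖.rng_one] at h
    rw [h]

theorem IsBisection.setInv {𝓖 : EtaleGroupoid X 𝒢} {T : Set 𝒢} (hT : 𝓖.IsBisection T) :
    𝓖.IsBisection (𝓖.setInv T) := by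
  rw [isBisection_iff] at hT ⊢
  obtain ⟨ho, hs, hr⟩ := hT
  refine ⟨?_, ?_, ?_⟩
  · rw [setInv_eq_preimage]
    exact ho.preimage 𝓖.continuous_inv
  · rintro _ ⟨a, ha, rfl⟩ _ ⟨b, hb, rfl⟩ h
    rw [𝓖.src_inv, 𝓖.src_inv] at h
    rw [hr ha hb h]
  · rintro _ ⟨a, ha, rfl⟩ _ ⟨b, hb, rfl⟩ h
    rw [𝓖.rng_inv, 𝓖.rng_inv] at h
    rw [hs ha hb h]

theorem IsBisection.setMul {𝓖 : EtaleGroupoid X 𝒢} {T S : Set 𝒢} (hT : 𝓖.IsBisection T)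
    (hS : 𝓖.IsBisection S) : 𝓖.IsBisection (𝓖.setMul T S) := by
  have hTi := (𝓖.isBisection_iff T).1 hT
  have hSi := (𝓖.isBisection_iff S).1 hS
  rw [isBisection_iff]
  refine ⟨?_, ?_, ?_⟩
  · let e := hT.isEmbedding_rng.toHomeomorph
    let V : Set 𝒢 := {α | 𝓖.rng α ∈ range (T.domRestrict 𝓖.rng)}
    have hV : IsOpen V := by
      have h1 : IsOpen (range (T.domRestrict 𝓖.rng)) := by
        rw [range_domRestrict]
        exact 𝓖.isLocalHomeomorph_rng.isOpenMap _ hT.isOpen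
      exact h1.preimage 𝓖.isLocalHomeomorph_rng.continuous
    let t : V → T := fun α => e.symm ⟨𝓖.rng α, α.2⟩
    have ht : Continuous t := e.symm.continuous.comp
      ((𝓖.isLocalHomeomorph_rng.continuous.comp continuous_subtype_val).subtype_mk _)
    have htr : ∀ α : V, 𝓖.rng (t α) = 𝓖.rng α := fun α =>
      congrArg Subtype.val (e.apply_symm_apply ⟨𝓖.rng α, α.2⟩)
    let F : V → 𝒢 := fun α => 𝓖.mul ⟨(𝓖.inv (t α), α), (𝓖.src_inv _).trans (htr α)⟩
    have hF : Continuous F := 𝓖.continuous_mul.comp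
      (((𝓖.continuous_inv.comp (continuous_subtype_val.comp ht)).prodMk
        continuous_subtype_val).subtype_mk _)
    have hEq : 𝓖.setMul T S = Subtype.val '' (F ⁻¹' S) := by
      ext α
      constructor
      · rintro ⟨⟨⟨a, b⟩, hab⟩, ha, hb, rfl⟩
        have hm : 𝓖.mul ⟨(a, b), hab⟩ ∈ V := ⟨⟨a, ha⟩, (𝓖.rng_mul ⟨(a, b), hab⟩).symm⟩
        refine ⟨⟨_, hm⟩, ?_, rfl⟩
        have hta : (t ⟨_, hm⟩ : 𝒢) = a :=
          hTi.2.2 (t ⟨_, hm⟩).2 ha ((htr _).trans (𝓖.rng_mul ⟨(a, b), hab⟩))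
        change 𝓖.mul _ ∈ S
        rw [𝓖.mul_congr _ (congrArg 𝓖.inv hta) rfl
          ((𝓖.src_inv a).trans (𝓖.rng_mul ⟨(a, b), hab⟩).symm), 𝓖.inv_mul_cancel_left]
        exact hb
      · rintro ⟨α, hα, rfl⟩
        refine ⟨⟨(t α, F α), ?_⟩, (t α).2, hα, ?_⟩
        · exact (𝓖.rng_inv _).symm.trans
            (𝓖.rng_mul ⟨(𝓖.inv (t α), α), (𝓖.src_inv _).trans (htr α)⟩).symm
        · exact 𝓖.mul_inv_cancel_left _ _ _ _
    rw [hEq]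
    exact hV.isOpenMap_subtype_val _ (hSi.1.preimage hF)
  · rintro _ ⟨⟨⟨a, b⟩, h⟩, ha, hb, rfl⟩ _ ⟨⟨⟨a', b'⟩, h'⟩, ha', hb', rfl⟩ he
    rw [𝓖.src_mul, 𝓖.src_mul] at he
    have hbb : b = b' := hSi.2.1 hb hb' he
    subst hbb
    exact 𝓖.mul_congr _ (hTi.2.1 ha ha' (h.trans h'.symm)) rfl _
  · rintro _ ⟨⟨⟨a, b⟩, h⟩, ha, hb, rfl⟩ _ ⟨⟨⟨a', b'⟩, h'⟩, ha', hb', rfl⟩ he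
    rw [𝓖.rng_mul, 𝓖.rng_mul] at he
    have haa : a = a' := hTi.2.2 ha ha' he
    subst haa
    exact 𝓖.mul_congr _ rfl (hSi.2.2 hb hb' (h.symm.trans h')) _

/-! ### The full group and the alternating full group -/

/-- Membership in the full group: bisections with source and range the whole unit space. -/
structure IsFullBisection (𝓖 : EtaleGroupoid X 𝒢) (T : Set 𝒢) : Prop where
  isBisection : 𝓖.IsBisection T
  src_image : 𝓖.src '' T = univ
  rng_image : 𝓖.rng '' T = univ

/-- The (topological) full group `F(𝓖)`. -/
def FullGroup (𝓖 : EtaleGroupoid X 𝒢) : Type v := {T : Set 𝒢 // 𝓖.IsFullBisection T}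

theorem IsFullBisection.setInv_setMul {𝓖 : EtaleGroupoid X 𝒢} {T : Set 𝒢}
    (hT : 𝓖.IsFullBisection T) : 𝓖.setMul (𝓖.setInv T) T = 𝓖.unitSet := by
  have hTi := (𝓖.isBisection_iff T).1 hT.isBisection
  ext α
  constructor
  · rintro ⟨⟨⟨_, b⟩, h⟩, ⟨a, ha, rfl⟩, hb, rfl⟩
    have hab : a = b := hTi.2.2 ha hb ((𝓖.src_inv a).symm.trans h)
    subst hab
    exact ⟨𝓖.src a, (𝓖.inv_mul a).symm⟩
  · rintro ⟨x, rfl⟩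
    obtain ⟨a, ha, rfl⟩ : x ∈ 𝓖.src '' T := hT.src_image ▸ mem_univ x
    exact ⟨_, ⟨a, ha, rfl⟩, ha, 𝓖.inv_mul a⟩

instance (𝓖 : EtaleGroupoid X 𝒢) : Group 𝓖.FullGroup where
  mul g h := ⟨𝓖.setMul g.1 h.1, g.2.isBisection.setMul h.2.isBisection, by
      refine eq_univ_of_forall fun x => ?_
      obtain ⟨b, hb, rfl⟩ : x ∈ 𝓖.src '' h.1 := h.2.src_image ▸ mem_univ x
      obtain ⟨a, ha, hab⟩ : 𝓖.rng b ∈ 𝓖.src '' g.1 := g.2.src_image ▸ mem_univ _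
      exact ⟨_, ⟨⟨(a, b), hab⟩, ha, hb, rfl⟩, 𝓖.src_mul _⟩, by
      refine eq_univ_of_forall fun x => ?_
      obtain ⟨a, ha, rfl⟩ : x ∈ 𝓖.rng '' g.1 := g.2.rng_image ▸ mem_univ x
      obtain ⟨b, hb, hab⟩ : 𝓖.src a ∈ 𝓖.rng '' h.1 := h.2.rng_image ▸ mem_univ _
      exact ⟨_, ⟨⟨(a, b), hab.symm⟩, ha, hb, rfl⟩, 𝓖.rng_mul _⟩⟩
  one := ⟨𝓖.unitSet, 𝓖.isBisection_unitSet,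
    eq_univ_of_forall fun x => ⟨_, ⟨x, rfl⟩, 𝓖.src_one x⟩,
    eq_univ_of_forall fun x => ⟨_, ⟨x, rfl⟩, 𝓖.rng_one x⟩⟩
  inv g := ⟨𝓖.setInv g.1, g.2.isBisection.setInv, by
      refine eq_univ_of_forall fun x => ?_
      obtain ⟨a, ha, rfl⟩ : x ∈ 𝓖.rng '' g.1 := g.2.rng_image ▸ mem_univ x
      exact ⟨_, ⟨a, ha, rfl⟩, 𝓖.src_inv a⟩, by
      refine eq_univ_of_forall fun x => ?_
      obtain ⟨a, ha, rfl⟩ : x ∈ 𝓖.src '' g.1 := g.2.src_image ▸ mem_univ x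
      exact ⟨_, ⟨a, ha, rfl⟩, 𝓖.rng_inv a⟩⟩
  mul_assoc g h k := Subtype.ext (𝓖.setMul_assoc g.1 h.1 k.1)
  one_mul g := Subtype.ext (𝓖.unitSet_setMul g.1)
  mul_one g := Subtype.ext (𝓖.setMul_unitSet g.1)
  inv_mul_cancel g := Subtype.ext g.2.setInv_setMul

/-- A multisection of degree `d`. -/
structure IsMultisection (𝓖 : EtaleGroupoid X 𝒢) {d : ℕ} (F : Fin d → Fin d → Set 𝒢) : Prop where
  isBisection : ∀ i j, 𝓖.IsBisection (F i j)
  /-- `F(i,i)` is a compact (and, being a bisection, open) subset of the unit space. -/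
  diag_subset : ∀ i, F i i ⊆ 𝓖.unitSet
  diag_compact : ∀ i, IsCompact (F i i)
  diag_disjoint : ∀ i j, i ≠ j → Disjoint (F i i) (F j j)
  mul : ∀ i j l, 𝓖.setMul (F i j) (F j l) = F i l

/-- The set of arrows `F(σ) = ⋃ᵢ F(σ(i), i) ⊔ (X ∖ ⋃ᵢ F(i, i))` attached to a multisection `F` and
a permutation `σ`. -/
def multisectionPerm (𝓖 : EtaleGroupoid X 𝒢) {d : ℕ} (F : Fin d → Fin d → Set 𝒢)
    (σ : Equiv.Perm (Fin d)) : Set 𝒢 :=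
  (⋃ i, F (σ i) i) ∪ (𝓖.unitSet \ ⋃ i, F i i)

/-- The alternating full group `A(𝓖)`, generated by the elements `F(σ)` of the full group, where
`F` is a multisection of degree `d ≥ 3` and `σ` an even permutation. -/
def alternatingFullGroup (𝓖 : EtaleGroupoid X 𝒢) : Subgroup 𝓖.FullGroup :=
  Subgroup.closure {g | ∃ d : ℕ, 3 ≤ d ∧ ∃ F : Fin d → Fin d → Set 𝒢, 𝓖.IsMultisection F ∧
    ∃ σ ∈ alternatingGroup (Fin d), g.1 = 𝓖.multisectionPerm F σ}

/-! ### Compact generation and orbital growth -/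

/-- Every arrow is contained in a finite product of members of `𝒮`. -/
def Generates (𝓖 : EtaleGroupoid X 𝒢) (𝒮 : Set (Set 𝒢)) : Prop :=
  ∀ γ, ∃ l : List (Set 𝒢), (∀ T ∈ l, T ∈ 𝒮) ∧ γ ∈ 𝓖.listProd l

/-- There is a compact set `K` of arrows such that every arrow is a product of elements of
`K ∪ K⁻¹`. -/
def IsCompactlyGenerated (𝓖 : EtaleGroupoid X 𝒢) : Prop :=
  ∃ K : Set 𝒢, IsCompact K ∧ 𝓖.Generates {K, 𝓖.setInv K}

/-- Finite symmetric generating sets consisting of compact open bisections. -/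
structure IsGeneratingSet (𝓖 : EtaleGroupoid X 𝒢) (𝒯 : Set (Set 𝒢)) : Prop where
  finite : 𝒯.Finite
  isBisection : ∀ T ∈ 𝒯, 𝓖.IsBisection T
  isCompact : ∀ T ∈ 𝒯, IsCompact T
  symm : ∀ T ∈ 𝒯, 𝓖.setInv T ∈ 𝒯
  generates : 𝓖.Generates 𝒯

/-- The orbital graph of `x`: its vertices are the points of the orbit of `x`, and `y`, `τ(T)(y)`
are joined by an edge for `T ∈ 𝒯` (loops and multiplicities, irrelevant for distances, are
dropped). -/
def orbitalGraph (𝓖 : EtaleGroupoid X 𝒢) (𝒯 : Set (Set 𝒢)) (x : X) : SimpleGraph (𝓖.orbit x) :=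
  SimpleGraph.fromRel fun y z => ∃ T ∈ 𝒯, ∃ γ ∈ T, 𝓖.src γ = y ∧ 𝓖.rng γ = z

/-- The orbital growth `β(n) = max_x |B(n, x)|`, where `B(n, x)` is the ball of radius `n` around
`x` in its orbital graph. -/
noncomputable def orbitalGrowth (𝓖 : EtaleGroupoid X 𝒢) (𝒯 : Set (Set 𝒢)) (n : ℕ) : ℕ∞ :=
  ⨆ x : X, {y : 𝓖.orbit x |
    (𝓖.orbitalGraph 𝒯 x).edist ⟨x, 𝓖.one x, 𝓖.src_one x, 𝓖.rng_one x⟩ y ≤ n}.encard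

theorem orbitalGraph_connected (𝓖 : EtaleGroupoid X 𝒢) {𝒯 : Set (Set 𝒢)}
    (h𝒯 : 𝓖.IsGeneratingSet 𝒯) (x : X) : (𝓖.orbitalGraph 𝒯 x).Connected := by
  have key : ∀ l : List (Set 𝒢), (∀ T ∈ l, T ∈ 𝒯) → ∀ γ ∈ 𝓖.listProd l,
      ∀ y z : 𝓖.orbit x, 𝓖.src γ = y → 𝓖.rng γ = z → (𝓖.orbitalGraph 𝒯 x).Reachable y z := by
    intro l
    induction l with
    | nil =>
      rintro _ _ ⟨p, rfl⟩ y z hy hz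
      rw [𝓖.src_one] at hy
      rw [𝓖.rng_one] at hz
      have : y = z := Subtype.ext (hy.symm.trans hz)
      rw [this]
    | cons T l ih =>
      rintro hl _ ⟨⟨⟨a, b⟩, hab⟩, ha, hb, rfl⟩ y z hy hz
      rw [𝓖.src_mul] at hy
      rw [𝓖.rng_mul] at hz
      have hw : 𝓖.rng b ∈ 𝓖.orbit x := by
        obtain ⟨γ, h1, h2⟩ := y.2
        have hc : 𝓖.src b = 𝓖.rng γ := hy.trans h2.symm
        exact ⟨𝓖.mul ⟨(b, γ), hc⟩, (𝓖.src_mul _).trans h1, 𝓖.rng_mul _⟩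
      refine (ih (fun S hS => hl S (List.mem_cons_of_mem _ hS)) b hb y ⟨_, hw⟩ hy rfl).trans ?_
      by_cases hwz : (⟨_, hw⟩ : 𝓖.orbit x) = z
      · rw [hwz]
      · exact SimpleGraph.Adj.reachable (show (𝓖.orbitalGraph 𝒯 x).Adj _ _ from
          ⟨hwz, Or.inl ⟨T, hl T List.mem_cons_self, a, ha, hab, hz⟩⟩)
  have h0 : ∀ y : 𝓖.orbit x, (𝓖.orbitalGraph 𝒯 x).Reachable
      ⟨x, 𝓖.one x, 𝓖.src_one x, 𝓖.rng_one x⟩ y := by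
    intro y
    obtain ⟨γ, h1, h2⟩ := y.2
    obtain ⟨l, hl, hγ⟩ := h𝒯.generates γ
    exact key l hl γ hγ _ _ h1 h2
  have : Nonempty (𝓖.orbit x) := ⟨⟨x, 𝓖.one x, 𝓖.src_one x, 𝓖.rng_one x⟩⟩
  exact ⟨fun y z => (h0 y).symm.trans (h0 z)⟩

/-- The orbit of `x`, regarded as a metric space through the graph distance of the orbital graph. -/
def OrbitalSpace (𝓖 : EtaleGroupoid X 𝒢) {𝒯 : Set (Set 𝒢)} (_h𝒯 : 𝓖.IsGeneratingSet 𝒯) (x : X) :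
    Type u := 𝓖.orbit x

/-- The unit underlying a point of the orbital space. -/
def OrbitalSpace.toUnit {𝓖 : EtaleGroupoid X 𝒢} {𝒯 : Set (Set 𝒢)} {h𝒯 : 𝓖.IsGeneratingSet 𝒯}
    {x : X} (y : 𝓖.OrbitalSpace h𝒯 x) : X := Subtype.val (p := (· ∈ 𝓖.orbit x)) y

noncomputable instance (𝓖 : EtaleGroupoid X 𝒢) {𝒯 : Set (Set 𝒢)} (h𝒯 : 𝓖.IsGeneratingSet 𝒯)
    (x : X) : MetricSpace (𝓖.OrbitalSpace h𝒯 x) :=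
  graphMetricSpace (𝓖.orbitalGraph_connected h𝒯 x)

end EtaleGroupoid

/-! ## Growth, wobbling groups and property `FG_f` -/

/-- `f ≼ g`: there is a constant `C > 0` with `f(n) ≤ C g(C n)` for every `n`. -/
def GrowthLE (f g : ℕ → ℕ∞) : Prop := ∃ C : ℕ, 0 < C ∧ ∀ n, f n ≤ C * g (C * n)

/-- The uniform growth `n ↦ sup_v |B(v, n)|` of a metric space. -/
noncomputable def uniformGrowth (Γ : Type w) [MetricSpace Γ] (n : ℕ) : ℕ∞ :=
  ⨆ v : Γ, (Metric.closedBall v (n : ℝ)).encard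

/-- Bounded geometry: the uniform growth is finite. In particular the metric space is discrete. -/
def BoundedGeometry (Γ : Type w) [MetricSpace Γ] : Prop := ∀ n, uniformGrowth Γ n < ⊤

/-- The wobbling group `W(Γ)`: the permutations of `Γ` of bounded displacement. -/
def wobblingGroup (Γ : Type w) [MetricSpace Γ] : Subgroup (Equiv.Perm Γ) where
  carrier := {σ | ∃ C : ℝ, ∀ v, dist v (σ v) ≤ C}
  one_mem' := ⟨0, fun v => by simp⟩
  mul_mem' := by
    rintro σ τ ⟨C, hC⟩ ⟨D, hD⟩
    exact ⟨D + C, fun v => (dist_triangle v (τ v) _).trans (add_le_add (hD v) (hC (τ v)))⟩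
  inv_mem' := by
    rintro σ ⟨C, hC⟩
    refine ⟨C, fun v => ?_⟩
    have h := hC (σ⁻¹ v)
    rwa [← Equiv.Perm.mul_apply, mul_inv_cancel, Equiv.Perm.one_apply, dist_comm] at h

/-- Property `FG_f` of a group `A`: for every discrete metric space `Γ` of bounded geometry whose
uniform growth is not `≽ f`, every homomorphism `A → W(Γ)` has finite image. -/
def HasPropertyFG (A : Type v) [Group A] (f : ℕ → ℕ∞) : Prop :=
  ∀ (Γ : Type w) [MetricSpace Γ], BoundedGeometry Γ → ¬ GrowthLE f (uniformGrowth Γ) →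
    ∀ ρ : A →* wobblingGroup Γ, (ρ.range : Set (wobblingGroup Γ)).Finite

/-!
The full group acts on the unit space by homeomorphisms, faithfully because the groupoid is
effective; identities in the full group are therefore checked on units.

*Rigidity.* Let the alternating full group `A` act nontrivially, by permutations of bounded
displacement, on a space `Γ`. Every arrow is locally implemented by an element of `A`: the source,
the range and a third point of the orbit span a multisection of degree three (`IsFrame`,
`exists_isFrame`, `IsMinimal.exists_nhds_smul_src_eq`). By compactness a finite subset `S` of `A`
connects all neighbours in the orbital graphs. So the points of a ball of radius `n` around a unit
`x` are `wᵢ x` for elements `wᵢ` of `A` which displace points of `Γ` by at most `L n`, with `L`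
independent of `n` and `x`.

It remains to find `u ∈ Γ` such that no three of the points `wᵢ u` coincide: then half of the
cardinality of the ball around `x` is a lower bound for that of the ball of radius `L n` around `u`.
Suppose that there is no such `u`, and let `U` be a neighbourhood of `x` with pairwise disjoint
translates `wᵢ U`. Let `E` be an alternating group of high degree of a multisection inside `U`. Its
conjugates by the `wᵢ` commute with one another. A pigeonhole argument over `E` and the fact that
`E` has no proper subgroups of small index show that the stabilizer of `u` contains elements `e f`
and `e f'` for every `e ∈ E`, where `f` and `f'` commute with `E` and with each other, lying in
conjugates of `E` by some `wᵢ⁻¹ wⱼ` and `wᵢ⁻¹ wₖ`; commutators of such elements lie in `E`, and `E`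
is perfect. Hence `E` fixes every `u`
(`le_ker_of_forall_three_coincidences`). At every unit a given multisection extends, after
restriction to a neighbourhood, to one with further components inside `U`, whose alternating group
is simple and meets the kernel; so the kernel is `A` (`IsMinimal.alternatingFullGroup_le`).

*Sharpness.* Balls in the orbital graphs are lower semicontinuous in their centre and orbits are
dense, so every orbit has uniform growth equal to the orbital growth
(`IsMinimal.uniformGrowth_orbitalSpace_eq`). An element of the full group is compact, hence covered
by finitely many products of generators, and displaces the points of an orbit by a bounded amount.
The action on a dense orbit is faithful and `A` is infinite, so an orbit, copied into the given
universe, violates the property for every function which is not dominated by the orbital growth.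
-/

/-! ### The Cantor space -/

theorem perfectSpace_of_homeomorph {X : Type*} [TopologicalSpace X] (e : X ≃ₜ (ℕ → Bool)) :
    PerfectSpace X := by
  rw [perfectSpace_iff_forall_not_isolated]
  intro x
  rw [Filter.neBot_iff, Ne, ← isOpen_singleton_iff_punctured_nhds]
  intro hx
  have h := e.isOpenMap _ hx
  rw [image_singleton, isOpen_pi_iff] at h
  obtain ⟨I, U, hU, hI⟩ := h (e x) rfl
  obtain ⟨n, hn⟩ := Infinite.exists_notMem_finset I
  have hm : Function.update (e x) n (!(e x n)) ∈ (I : Set ℕ).pi U := by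
    intro i hi
    have hne : i ≠ n := by rintro rfl; exact hn hi
    rw [Function.update_of_ne hne]
    exact (hU i hi).2
  have := congrFun (hI hm) n
  simp at this

namespace EtaleGroupoid

variable {X : Type u} {𝒢 : Type v} [TopologicalSpace X] [TopologicalSpace 𝒢]
  {𝓖 : EtaleGroupoid X 𝒢}

/-! ### Bisections and orbits -/

theorem IsBisection.injOn_src {T : Set 𝒢} (hT : 𝓖.IsBisection T) : InjOn 𝓖.src T :=
  ((𝓖.isBisection_iff T).1 hT).2.1

theorem IsBisection.injOn_rng {T : Set 𝒢} (hT : 𝓖.IsBisection T) : InjOn 𝓖.rng T :=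
  ((𝓖.isBisection_iff T).1 hT).2.2

theorem IsBisection.mono {T S : Set 𝒢} (hT : 𝓖.IsBisection T) (hS : IsOpen S) (h : S ⊆ T) :
    𝓖.IsBisection S :=
  (𝓖.isBisection_iff S).2 ⟨hS, hT.injOn_src.mono h, hT.injOn_rng.mono h⟩

theorem exists_isBisection_subset (𝓖 : EtaleGroupoid X 𝒢) {γ : 𝒢} {O : Set 𝒢} (hO : IsOpen O)
    (hγ : γ ∈ O) : ∃ T, 𝓖.IsBisection T ∧ γ ∈ T ∧ T ⊆ O := by
  obtain ⟨e, he, hes⟩ := 𝓖.isLocalHomeomorph_src γ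
  obtain ⟨e', he', hes'⟩ := 𝓖.isLocalHomeomorph_rng γ
  refine ⟨e.source ∩ e'.source ∩ O, ?_, ⟨⟨he, he'⟩, hγ⟩, inter_subset_right⟩
  rw [isBisection_iff]
  refine ⟨(e.open_source.inter e'.open_source).inter hO, ?_, ?_⟩
  · rw [hes]; exact e.injOn.mono (fun x hx => hx.1.1)
  · rw [hes']; exact e'.injOn.mono (fun x hx => hx.1.2)

/-- The part of a bisection lying over a compact subset of its source is compact. -/
theorem IsBisection.isCompact_inter_preimage {T : Set 𝒢} (hT : 𝓖.IsBisection T) {W : Set X}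
    (hW : IsCompact W) (h : W ⊆ 𝓖.src '' T) : IsCompact (T ∩ 𝓖.src ⁻¹' W) := by
  have h1 : IsCompact ((T.domRestrict 𝓖.src) ⁻¹' W) := by
    refine hT.isEmbedding_src.isInducing.isCompact_preimage_iff ?_ |>.2 hW
    rwa [range_domRestrict]
  have h2 := h1.image (continuous_subtype_val (p := (· ∈ T)))
  convert h2 using 1
  ext γ
  simp [and_comm]

theorem mem_orbit_self (𝓖 : EtaleGroupoid X 𝒢) (x : X) : x ∈ 𝓖.orbit x :=
  ⟨𝓖.one x, 𝓖.src_one x, 𝓖.rng_one x⟩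

theorem rng_mem_orbit {x : X} {γ : 𝒢} (h : 𝓖.src γ ∈ 𝓖.orbit x) : 𝓖.rng γ ∈ 𝓖.orbit x := by
  obtain ⟨δ, h1, h2⟩ := h
  exact ⟨𝓖.mul ⟨(γ, δ), h2.symm⟩, (𝓖.src_mul _).trans h1, 𝓖.rng_mul _⟩

theorem IsMinimal.infinite_orbit_inter [T1Space X] [PerfectSpace X] (h : 𝓖.IsMinimal) (x : X)
    {U : Set X} (hU : IsOpen U) (hne : U.Nonempty) : (𝓖.orbit x ∩ U).Infinite := by
  intro hf
  obtain ⟨y, hy, hyU⟩ := ((h x).sdiff_finite hf).inter_open_nonempty U hU hne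
  exact hyU.2 ⟨hyU.1, hy⟩

theorem IsMinimal.infinite_orbit [T1Space X] [PerfectSpace X] (h : 𝓖.IsMinimal) (x : X) :
    (𝓖.orbit x).Infinite := by
  simpa using h.infinite_orbit_inter x isOpen_univ ⟨x, trivial⟩

/-! ### The action of the full group on the unit space -/

theorem FullGroup.exists_src_eq (g : 𝓖.FullGroup) (x : X) : ∃ γ, γ ∈ g.1 ∧ 𝓖.src γ = x := by
  obtain ⟨γ, h, rfl⟩ : x ∈ 𝓖.src '' g.1 := g.2.src_image ▸ mem_univ x
  exact ⟨γ, h, rfl⟩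

/-- An element `g` of the full group acts on the unit space by the homeomorphism `τ(g)`. -/
noncomputable instance : SMul 𝓖.FullGroup X where
  smul g x := 𝓖.rng (g.exists_src_eq x).choose

theorem FullGroup.smul_src {g : 𝓖.FullGroup} {γ : 𝒢} (h : γ ∈ g.1) : g • 𝓖.src γ = 𝓖.rng γ :=
  congrArg 𝓖.rng (g.2.isBisection.injOn_src (g.exists_src_eq (𝓖.src γ)).choose_spec.1 h
    (g.exists_src_eq (𝓖.src γ)).choose_spec.2)

theorem FullGroup.exists_arrow (g : 𝓖.FullGroup) (x : X) :
    ∃ γ ∈ g.1, 𝓖.src γ = x ∧ 𝓖.rng γ = g • x := by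
  obtain ⟨γ, h, rfl⟩ := g.exists_src_eq x
  exact ⟨γ, h, rfl, (smul_src h).symm⟩

noncomputable instance : MulAction 𝓖.FullGroup X where
  one_smul x := by
    have := FullGroup.smul_src (g := (1 : 𝓖.FullGroup)) (γ := 𝓖.one x) ⟨x, rfl⟩
    rwa [𝓖.src_one, 𝓖.rng_one] at this
  mul_smul g h x := by
    obtain ⟨β, hβ, rfl, hβ'⟩ := h.exists_arrow x
    obtain ⟨α, hα, hα', hα''⟩ := g.exists_arrow (𝓖.rng β)
    have := FullGroup.smul_src (g := g * h) (γ := 𝓖.mul ⟨(α, β), hα'⟩) ⟨_, hα, hβ, rfl⟩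
    rw [𝓖.src_mul, 𝓖.rng_mul] at this
    rw [this, ← hβ', ← hα'']

theorem FullGroup.tauGraph_eq (g : 𝓖.FullGroup) : 𝓖.tauGraph g.1 = {p | g • p.1 = p.2} := by
  ext ⟨x, y⟩
  constructor
  · rintro ⟨γ, h, he⟩
    cases he
    exact smul_src h
  · intro hxy
    obtain ⟨γ, h, rfl, h'⟩ := g.exists_arrow x
    exact ⟨γ, h, Prod.ext rfl (h'.trans hxy)⟩

theorem IsEffective.fullGroup_ext (heff : 𝓖.IsEffective) {g h : 𝓖.FullGroup}
    (hgh : ∀ x : X, g • x = h • x) : g = h := by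
  refine Subtype.ext (heff _ _ g.2.isBisection h.2.isBisection ?_)
  simp_rw [FullGroup.tauGraph_eq, hgh]

theorem FullGroup.continuous_smul (g : 𝓖.FullGroup) : Continuous fun x : X => g • x := by
  rw [continuous_def]
  intro U hU
  have : (fun x : X => g • x) ⁻¹' U = 𝓖.src '' (g.1 ∩ 𝓖.rng ⁻¹' U) := by
    ext x
    constructor
    · intro hx
      obtain ⟨γ, h, rfl, h'⟩ := g.exists_arrow x
      exact ⟨γ, ⟨h, by rw [mem_preimage, h']; exact hx⟩, rfl⟩
    · rintro ⟨γ, ⟨h, h'⟩, rfl⟩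
      rw [mem_preimage, smul_src h]
      exact h'
  rw [this]
  exact 𝓖.isLocalHomeomorph_src.isOpenMap _
    (g.2.isBisection.isOpen.inter (hU.preimage 𝓖.isLocalHomeomorph_rng.continuous))

theorem FullGroup.smul_mem_orbit (g : 𝓖.FullGroup) {x y : X} (h : y ∈ 𝓖.orbit x) :
    g • y ∈ 𝓖.orbit x := by
  obtain ⟨γ, -, rfl, h'⟩ := g.exists_arrow y
  exact h' ▸ rng_mem_orbit h

end EtaleGroupoid

/-! ### Finite alternating groups acting through disjoint conjugates -/

/-- A subgroup of small index in an alternating group is everything: its normal core is not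
trivial, for the index of the core divides the factorial of the index. -/
theorem alternatingGroup_eq_top_of_index_add_three_le {α : Type*} [Fintype α] [DecidableEq α]
    (h5 : 5 ≤ Nat.card α) (K : Subgroup (alternatingGroup α)) (hK : K.index + 3 ≤ Nat.card α) :
    K = ⊤ := by
  have h := alternatingGroup.normal_subgroup_eq_bot_or_eq_top h5 (N := K.normalCore)
  rcases h with h | h
  · exfalso
    have h1 : K.normalCore.index ∣ Nat.factorial K.index := by
      rw [Subgroup.normalCore_eq_ker, Subgroup.index_ker, Subgroup.index_eq_card, ← Nat.card_perm]
      exact Subgroup.card_subgroup_dvd_card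
        (MulAction.toPermHom (alternatingGroup α) (alternatingGroup α ⧸ K)).range
    rw [h, Subgroup.index_bot] at h1
    have h2 := Nat.le_of_dvd (Nat.factorial_pos _) h1
    have : Nontrivial α := by
      rw [← Finite.one_lt_card_iff_nontrivial]; omega
    have h3 := two_mul_nat_card_alternatingGroup (α := α)
    rw [Nat.card_perm] at h3
    have h4 := Nat.factorial_le hK
    rw [Nat.factorial_succ, Nat.factorial_succ, Nat.factorial_succ] at h4
    have h5 := Nat.factorial_pos K.index
    nlinarith [Nat.zero_le (K.index * Nat.factorial K.index),
      Nat.zero_le (K.index * K.index * Nat.factorial K.index),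
      Nat.zero_le (K.index * K.index * K.index * Nat.factorial K.index)]
  · exact top_le_iff.1 (h ▸ K.normalCore_le)

open scoped commutatorElement in
theorem commutatorElement_mul_mul_of_commute {A : Type*} [Group A] {a b a' b' : A}
    (h1 : Commute b a') (h2 : Commute b b') (h3 : Commute b' a) : ⁅a * b, a' * b'⁆ = ⁅a, a'⁆ := by
  rw [commutatorElement_def, commutatorElement_def]
  have e1 : a * b * (a' * b') = a * (a' * b') * b := by
    rw [mul_assoc, (h1.mul_right h2).eq, ← mul_assoc]
  have e2 : b' * a⁻¹ = a⁻¹ * b' := h3.inv_right.eq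
  calc a * b * (a' * b') * (a * b)⁻¹ * (a' * b')⁻¹
      = a * a' * (b' * a⁻¹) * b'⁻¹ * a'⁻¹ := by rw [e1]; group
    _ = a * a' * a⁻¹ * a'⁻¹ := by rw [e2]; group

/-- Suppose that `w₁, …, w_N` conjugate the image of a finite perfect group `E` without proper
subgroups of small index to pairwise commuting subgroups. If under every point of a set on which
the ambient group acts three of the `wᵢ` coincide, then `E` acts trivially on that set.

For a point `u` and many `a ∈ E`, the same three indices `i, j, k` work for `a u`. So the
stabilizer of `u` contains, for every `e ∈ E`, elements `e f` and `e f'` with `f` and `f'` in the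
conjugates of `E` by `wᵢ⁻¹ wⱼ` and `wᵢ⁻¹ wₖ`. A commutator `[e₁ f, e₂ f'] = [e₁, e₂]` no longer
involves `f` and `f'`. -/
theorem le_ker_of_forall_three_coincidences {A Γ I E : Type*} [Group A] [Group E] [Finite E]
    [Fintype I] (ρ : A →* Equiv.Perm Γ) (ι : E →* A) (w : I → A)
    (hcomm : ∀ i j, i ≠ j → ∀ a b,
      Commute (w i * ι a * (w i)⁻¹) (w j * ι b * (w j)⁻¹))
    (hE : commutator E = ⊤)
    (hidx : ∀ K : Subgroup E, K.index ≤ Fintype.card I ^ 3 → K = ⊤)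
    (hcoin : ∀ u : Γ, ∃ i j k, i ≠ j ∧ i ≠ k ∧ j ≠ k ∧ ρ (w i) u = ρ (w j) u ∧
      ρ (w i) u = ρ (w k) u) :
    ι.range ≤ ρ.ker := by
  classical
  have := Fintype.ofFinite E
  suffices h : ∀ u : Γ, (⊤ : Subgroup E) ≤
      ((MulAction.stabilizer (Equiv.Perm Γ) u).comap ρ).comap ι by
    rintro _ ⟨e, rfl⟩
    exact Equiv.ext fun u => h u (Subgroup.mem_top e)
  intro u
  set H := (MulAction.stabilizer (Equiv.Perm Γ) u).comap ρ with hH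
  have hmem : ∀ a, a ∈ H ↔ ρ a u = u := fun a => Iff.rfl
  choose t₁ t₂ t₃ h12 h13 h23 he2 he3 using fun a : E => hcoin (ρ (ι a) u)
  let t : E → I × I × I := fun a => (t₁ a, t₂ a, t₃ a)
  have : Nonempty (I × I × I) := ⟨t 1⟩
  obtain ⟨⟨i, j, k⟩, -, hmax⟩ := Finset.exists_max_image (Finset.univ : Finset (I × I × I))
    (fun y => (Finset.univ.filter fun a => t a = y).card) Finset.univ_nonempty
  set Y := Finset.univ.filter fun a => t a = (i, j, k) with hY
  have hYcard : Fintype.card E ≤ Y.card * Fintype.card I ^ 3 := by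
    have := Finset.card_le_mul_card_image_of_maps_to (s := Finset.univ) (f := t)
      (t := Finset.univ) (fun _ _ => Finset.mem_univ _) Y.card
      (fun b _ => hmax b (Finset.mem_univ b))
    simpa [pow_succ, mul_assoc] using this
  have hYt : ∀ a ∈ Y, t₁ a = i ∧ t₂ a = j ∧ t₃ a = k := by
    intro a ha
    simpa [hY, t] using ha
  have hYne : Y.Nonempty := by
    rw [Finset.nonempty_iff_ne_empty]
    intro h
    rw [h, Finset.card_empty, zero_mul] at hYcard
    exact Fintype.card_ne_zero (Nat.le_zero.1 hYcard)
  obtain ⟨a₀, ha₀⟩ := hYne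
  have hij : i ≠ j := by obtain ⟨rfl, rfl, rfl⟩ := hYt _ ha₀; exact h12 a₀
  have hik : i ≠ k := by obtain ⟨rfl, rfl, rfl⟩ := hYt _ ha₀; exact h13 a₀
  have hjk : j ≠ k := by obtain ⟨rfl, rfl, rfl⟩ := hYt _ ha₀; exact h23 a₀
  -- the conjugates of `E` by `wᵢ⁻¹ wₗ`
  let c : I → E →* A := fun l => (MulAut.conj ((w i)⁻¹ * w l)).toMonoidHom.comp ι
  have hc : ∀ l f, c l f = (w i)⁻¹ * (w l * ι f * (w l)⁻¹) * w i := by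
    intro l f
    simp only [c, MonoidHom.comp_apply, MulEquiv.toMonoidHom_eq_coe, MonoidHom.coe_coe,
      MulAut.conj_apply]
    group
  have hconj : ∀ p q : A, Commute (w i * p * (w i)⁻¹) q → Commute p ((w i)⁻¹ * q * w i) := by
    intro p q h
    have := (Commute.conj_iff (w i)⁻¹).2 h
    convert this using 1 <;> group
  have hcι : ∀ l, i ≠ l → ∀ e f, Commute (ι e) (c l f) := by
    intro l hl e f
    rw [hc]
    exact hconj _ _ (hcomm i l hl e f)
  have hcc : ∀ f f', Commute (c j f) (c k f') := by
    intro f f'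
    rw [hc k]
    refine hconj _ _ ?_
    have : w i * c j f * (w i)⁻¹ = w j * ι f * (w j)⁻¹ := by rw [hc]; group
    rw [this]
    exact hcomm j k hjk f f'
  have key : ∀ l, i ≠ l → (∀ a ∈ Y, ρ (w i) (ρ (ι a) u) = ρ (w l) (ρ (ι a) u)) →
      ∀ e, ∃ f, ι e * c l f ∈ H := by
    intro l hl hYl
    let P := MonoidHom.noncommCoprod ι (c l) (hcι l hl)
    let K := (H.comap P).map (MonoidHom.fst E E)
    have hK : ∀ e, e ∈ K → ∃ f, ι e * c l f ∈ H := by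
      rintro _ ⟨⟨e, f⟩, h, rfl⟩
      exact ⟨f, h⟩
    have hYK : ∀ b ∈ Y, a₀⁻¹ * b ∈ K := by
      intro b hb
      refine ⟨(a₀⁻¹ * b, a₀ * b⁻¹), ?_, rfl⟩
      change ι (a₀⁻¹ * b) * c l (a₀ * b⁻¹) ∈ H
      have e1 : ι (a₀⁻¹ * b) * c l (a₀ * b⁻¹) =
          ((w l * ι a₀)⁻¹ * (w i * ι a₀))⁻¹ * ((w l * ι b)⁻¹ * (w i * ι b)) := by
        rw [map_mul, mul_assoc, (hcι l hl b (a₀ * b⁻¹)).eq, hc]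
        simp only [map_mul, map_inv]
        group
      rw [e1]
      have e2 : ∀ a ∈ Y, (w l * ι a)⁻¹ * (w i * ι a) ∈ H := by
        intro a ha
        rw [hmem, map_mul, Equiv.Perm.mul_apply, map_inv, Equiv.Perm.inv_eq_iff_eq, map_mul,
          map_mul, Equiv.Perm.mul_apply, Equiv.Perm.mul_apply]
        exact hYl a ha
      exact H.mul_mem (H.inv_mem (e2 a₀ ha₀)) (e2 b hb)
    have hYle : Y.card ≤ Nat.card K := by
      rw [← Nat.card_eq_finsetCard]
      refine Nat.card_le_card_of_injective
        (fun b : Y => (⟨a₀⁻¹ * b, hYK b b.2⟩ : K)) ?_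
      intro b b' hbb
      exact Subtype.ext (mul_left_cancel (congrArg Subtype.val hbb))
    have hKtop : K = ⊤ := by
      refine hidx K ?_
      have h1 := K.index_mul_card
      rw [Nat.card_eq_fintype_card (α := E)] at h1
      refine Nat.le_of_mul_le_mul_right ?_ (Nat.card_pos (α := K))
      rw [h1, mul_comm]
      exact hYcard.trans (Nat.mul_le_mul_right _ hYle)
    exact fun e => hK e (hKtop ▸ Subgroup.mem_top e)
  have keyj := key j hij fun a ha => by
    obtain ⟨h1, h2, -⟩ := hYt a ha
    have := he2 a
    rwa [h1, h2] at this
  have keyk := key k hik fun a ha => by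
    obtain ⟨h1, -, h2⟩ := hYt a ha
    have := he3 a
    rwa [h1, h2] at this
  rw [← hE, commutator_def, Subgroup.commutator_le]
  intro e₁ _ e₂ _
  obtain ⟨f, hf⟩ := keyj e₁
  obtain ⟨f', hf'⟩ := keyk e₂
  rw [Subgroup.mem_comap, map_commutatorElement,
    ← commutatorElement_mul_mul_of_commute (hcι j hij e₂ f).symm (hcc f f') (hcι k hik e₁ f').symm,
    commutatorElement_def]
  exact H.mul_mem (H.mul_mem (H.mul_mem hf hf') (H.inv_mem hf)) (H.inv_mem hf')

namespace EtaleGroupoid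

variable {X : Type u} {𝒢 : Type v} [TopologicalSpace X] [TopologicalSpace 𝒢]
  {𝓖 : EtaleGroupoid X 𝒢}

/-! ### Multisections and the permutations they define -/

namespace IsMultisection

variable {d : ℕ} {F : Fin d → Fin d → Set 𝒢}

theorem one_src_mem (hF : 𝓖.IsMultisection F) {i j : Fin d} {γ : 𝒢} (h : γ ∈ F i j) :
    𝓖.one (𝓖.src γ) ∈ F j j := by
  rw [← hF.mul i j j] at h
  obtain ⟨⟨⟨a, b⟩, hab⟩, -, hb, rfl⟩ := h
  obtain ⟨x, rfl⟩ := hF.diag_subset j hb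
  rw [𝓖.src_mul, 𝓖.src_one]
  exact hb

theorem one_rng_mem (hF : 𝓖.IsMultisection F) {i j : Fin d} {γ : 𝒢} (h : γ ∈ F i j) :
    𝓖.one (𝓖.rng γ) ∈ F i i := by
  rw [← hF.mul i i j] at h
  obtain ⟨⟨⟨a, b⟩, hab⟩, ha, -, rfl⟩ := h
  obtain ⟨x, rfl⟩ := hF.diag_subset i ha
  rw [𝓖.rng_mul, 𝓖.rng_one]
  exact ha

theorem exists_src_eq (hF : 𝓖.IsMultisection F) {j : Fin d} {x : X}
    (h : 𝓖.one x ∈ F j j) (i : Fin d) :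
    ∃ γ ∈ F i j, 𝓖.src γ = x := by
  rw [← hF.mul j i j] at h
  obtain ⟨⟨⟨a, b⟩, hab⟩, -, hb, he⟩ := h
  exact ⟨b, hb, by rw [← 𝓖.src_one x, ← he, 𝓖.src_mul]⟩

theorem exists_rng_eq (hF : 𝓖.IsMultisection F) {i : Fin d} {x : X}
    (h : 𝓖.one x ∈ F i i) (j : Fin d) :
    ∃ γ ∈ F i j, 𝓖.rng γ = x := by
  rw [← hF.mul i j i] at h
  obtain ⟨⟨⟨a, b⟩, hab⟩, ha, -, he⟩ := h
  exact ⟨a, ha, by rw [← 𝓖.rng_one x, ← he, 𝓖.rng_mul]⟩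

theorem eq_of_mem (hF : 𝓖.IsMultisection F) {i j : Fin d} {x : X} (hi : 𝓖.one x ∈ F i i)
    (hj : 𝓖.one x ∈ F j j) : i = j := by
  by_contra h
  exact disjoint_left.1 (hF.diag_disjoint i j h) hi hj

theorem isFullBisection [T2Space X] (hF : 𝓖.IsMultisection F) (σ : Equiv.Perm (Fin d)) :
    𝓖.IsFullBisection (𝓖.multisectionPerm F σ) := by
  refine ⟨(𝓖.isBisection_iff _).2 ⟨?_, ?_, ?_⟩, ?_, ?_⟩
  · refine (isOpen_iUnion fun i => (hF.isBisection _ _).isOpen).union ?_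
    have h : 𝓖.unitSet \ ⋃ i, F i i = 𝓖.unitSet ∩ 𝓖.src ⁻¹' (⋃ i, 𝓖.src '' F i i)ᶜ := by
      ext γ
      simp only [mem_sdiff, mem_iUnion, not_exists, mem_inter_iff, mem_preimage, mem_compl_iff,
        and_congr_right_iff]
      rintro ⟨x, rfl⟩
      refine forall_congr' fun i => not_congr ⟨fun h => ⟨_, h, rfl⟩, ?_⟩
      rintro ⟨δ, hδ, hx⟩
      obtain ⟨y, rfl⟩ := hF.diag_subset i hδ
      rw [𝓖.src_one, 𝓖.src_one] at hx
      exact hx ▸ hδ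
    rw [h]
    refine 𝓖.isBisection_unitSet.isOpen.inter
      (IsOpen.preimage 𝓖.isLocalHomeomorph_src.continuous ?_)
    exact (isClosed_iUnion_of_finite fun i =>
      ((hF.diag_compact i).image 𝓖.isLocalHomeomorph_src.continuous).isClosed).isOpen_compl
  · rintro γ (h | ⟨⟨x, rfl⟩, h⟩) δ (h' | ⟨⟨y, rfl⟩, h'⟩) he
    · obtain ⟨i, hi⟩ := mem_iUnion.1 h
      obtain ⟨j, hj⟩ := mem_iUnion.1 h'
      obtain rfl := hF.eq_of_mem (hF.one_src_mem hi) (he ▸ hF.one_src_mem hj)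
      exact (hF.isBisection _ _).injOn_src hi hj he
    · obtain ⟨i, hi⟩ := mem_iUnion.1 h
      have := hF.one_src_mem hi
      rw [he, 𝓖.src_one] at this
      exact (h' (mem_iUnion.2 ⟨i, this⟩)).elim
    · obtain ⟨i, hi⟩ := mem_iUnion.1 h'
      have := hF.one_src_mem hi
      rw [← he, 𝓖.src_one] at this
      exact (h (mem_iUnion.2 ⟨i, this⟩)).elim
    · rw [𝓖.src_one, 𝓖.src_one] at he
      rw [he]
  · rintro γ (h | ⟨⟨x, rfl⟩, h⟩) δ (h' | ⟨⟨y, rfl⟩, h'⟩) he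
    · obtain ⟨i, hi⟩ := mem_iUnion.1 h
      obtain ⟨j, hj⟩ := mem_iUnion.1 h'
      obtain rfl := σ.injective (hF.eq_of_mem (hF.one_rng_mem hi) (he ▸ hF.one_rng_mem hj))
      exact (hF.isBisection _ _).injOn_rng hi hj he
    · obtain ⟨i, hi⟩ := mem_iUnion.1 h
      have := hF.one_rng_mem hi
      rw [he, 𝓖.rng_one] at this
      exact (h' (mem_iUnion.2 ⟨_, this⟩)).elim
    · obtain ⟨i, hi⟩ := mem_iUnion.1 h'
      have := hF.one_rng_mem hi
      rw [← he, 𝓖.rng_one] at this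
      exact (h (mem_iUnion.2 ⟨_, this⟩)).elim
    · rw [𝓖.rng_one, 𝓖.rng_one] at he
      rw [he]
  · refine eq_univ_of_forall fun x => ?_
    by_cases hx : ∃ i, 𝓖.one x ∈ F i i
    · obtain ⟨i, hi⟩ := hx
      obtain ⟨γ, h, rfl⟩ := hF.exists_src_eq hi (σ i)
      exact ⟨γ, Or.inl (mem_iUnion.2 ⟨i, h⟩), rfl⟩
    · exact ⟨𝓖.one x, Or.inr ⟨⟨x, rfl⟩, by simpa using hx⟩, 𝓖.src_one x⟩
  · refine eq_univ_of_forall fun x => ?_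
    by_cases hx : ∃ i, 𝓖.one x ∈ F i i
    · obtain ⟨i, hi⟩ := hx
      obtain ⟨γ, h, rfl⟩ := hF.exists_rng_eq hi (σ.symm i)
      exact ⟨γ, Or.inl (mem_iUnion.2 ⟨σ.symm i, by rwa [σ.apply_symm_apply]⟩), rfl⟩
    · exact ⟨𝓖.one x, Or.inr ⟨⟨x, rfl⟩, by simpa using hx⟩, 𝓖.rng_one x⟩

theorem smul_src {σ : Equiv.Perm (Fin d)} {g : 𝓖.FullGroup} (hg : g.1 = 𝓖.multisectionPerm F σ)
    {i : Fin d} {γ : 𝒢} (h : γ ∈ F (σ i) i) : g • 𝓖.src γ = 𝓖.rng γ :=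
  FullGroup.smul_src (hg ▸ Or.inl (mem_iUnion.2 ⟨i, h⟩))

theorem smul_eq_self {σ : Equiv.Perm (Fin d)} {g : 𝓖.FullGroup}
    (hg : g.1 = 𝓖.multisectionPerm F σ) {x : X} (h : ∀ i, 𝓖.one x ∉ F i i) : g • x = x := by
  have h1 : 𝓖.one x ∈ g.1 := hg ▸ Or.inr ⟨⟨x, rfl⟩, by simpa using h⟩
  have := FullGroup.smul_src h1
  rwa [𝓖.src_one, 𝓖.rng_one] at this

end IsMultisection

/-! ### Frames -/

/-- A frame over `W`: a finite family of compact open bisections with the same source `W` and with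
pairwise disjoint ranges. Frames are multisections seen from one of their components, namely
`F(i, j) = T i (T j)⁻¹`; they have the advantage that they can be prescribed at a point. -/
structure IsFrame (𝓖 : EtaleGroupoid X 𝒢) {ι : Type*} (T : ι → Set 𝒢) (W : Set X) : Prop where
  isBisection : ∀ i, 𝓖.IsBisection (T i)
  isCompact : ∀ i, IsCompact (T i)
  src_image : ∀ i, 𝓖.src '' T i = W
  disjoint : ∀ i j, i ≠ j → Disjoint (𝓖.rng '' T i) (𝓖.rng '' T j)

theorem mem_setMul_setInv {T S : Set 𝒢} {γ : 𝒢} : γ ∈ 𝓖.setMul T (𝓖.setInv S) ↔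
    ∃ α ∈ T, ∃ β ∈ S, ∃ h : 𝓖.src α = 𝓖.src β,
      γ = 𝓖.mul ⟨(α, 𝓖.inv β), h.trans (𝓖.rng_inv β).symm⟩ := by
  constructor
  · rintro ⟨⟨⟨α, _⟩, h⟩, hα, ⟨β, hβ, rfl⟩, rfl⟩
    exact ⟨α, hα, β, hβ, h.trans (𝓖.rng_inv β), rfl⟩
  · rintro ⟨α, hα, β, hβ, h, rfl⟩
    exact ⟨_, hα, ⟨β, hβ, rfl⟩, rfl⟩

namespace IsFrame

variable {ι : Type*} {T : ι → Set 𝒢} {W : Set X}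

theorem comp_injective {κ : Type*} (hT : 𝓖.IsFrame T W) {f : κ → ι} (hf : Function.Injective f) :
    𝓖.IsFrame (T ∘ f) W where
  isBisection _ := hT.isBisection _
  isCompact _ := hT.isCompact _
  src_image _ := hT.src_image _
  disjoint _ _ h := hT.disjoint _ _ (hf.ne h)

theorem src_mem (hT : 𝓖.IsFrame T W) {i : ι} {γ : 𝒢} (h : γ ∈ T i) : 𝓖.src γ ∈ W :=
  hT.src_image i ▸ mem_image_of_mem _ h

theorem exists_src_eq (hT : 𝓖.IsFrame T W) {x : X} (h : x ∈ W) (i : ι) :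
    ∃ γ ∈ T i, 𝓖.src γ = x := by
  rwa [← hT.src_image i] at h

theorem isOpen_base (hT : 𝓖.IsFrame T W) (i : ι) : IsOpen W :=
  hT.src_image i ▸ 𝓖.isLocalHomeomorph_src.isOpenMap _ (hT.isBisection i).isOpen

theorem isCompact_base (hT : 𝓖.IsFrame T W) (i : ι) : IsCompact W :=
  hT.src_image i ▸ (hT.isCompact i).image 𝓖.isLocalHomeomorph_src.continuous

theorem restrict (hT : 𝓖.IsFrame T W) {V : Set X} (hV : IsOpen V) (hVc : IsCompact V)
    (hVW : V ⊆ W) : 𝓖.IsFrame (fun i => T i ∩ 𝓖.src ⁻¹' V) V where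
  isBisection i := (hT.isBisection i).mono ((hT.isBisection i).isOpen.inter
    (hV.preimage 𝓖.isLocalHomeomorph_src.continuous)) inter_subset_left
  isCompact i := (hT.isBisection i).isCompact_inter_preimage hVc (hT.src_image i ▸ hVW)
  src_image i := by
    rw [image_inter_preimage, hT.src_image, inter_eq_right.2 hVW]
  disjoint i j h := (hT.disjoint i j h).mono (image_mono inter_subset_left)
    (image_mono inter_subset_left)

theorem mul_inv_self (hT : 𝓖.IsFrame T W) (i : ι) :
    𝓖.setMul (T i) (𝓖.setInv (T i)) = 𝓖.one '' (𝓖.rng '' T i) := by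
  ext γ
  rw [mem_setMul_setInv]
  constructor
  · rintro ⟨α, hα, β, hβ, h, rfl⟩
    obtain rfl := (hT.isBisection i).injOn_src hα hβ h
    exact ⟨_, ⟨α, hα, rfl⟩, (𝓖.mul_inv α).symm⟩
  · rintro ⟨_, ⟨α, hα, rfl⟩, rfl⟩
    exact ⟨α, hα, α, hα, rfl, (𝓖.mul_inv α).symm⟩

theorem isMultisection {d : ℕ} {T : Fin d → Set 𝒢} (hT : 𝓖.IsFrame T W) :
    𝓖.IsMultisection fun i j => 𝓖.setMul (T i) (𝓖.setInv (T j)) where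
  isBisection _ _ := (hT.isBisection _).setMul (hT.isBisection _).setInv
  diag_subset i := by
    rw [hT.mul_inv_self]
    exact image_subset_range _ _
  diag_compact i := by
    rw [hT.mul_inv_self]
    exact ((hT.isCompact i).image 𝓖.isLocalHomeomorph_rng.continuous).image
      𝓖.isEmbedding_one.continuous
  diag_disjoint i j h := by
    rw [hT.mul_inv_self, hT.mul_inv_self]
    exact (disjoint_image_iff 𝓖.isEmbedding_one.injective).2 (hT.disjoint i j h)
  mul _ j _ := by
    -- `(α β⁻¹) (β δ⁻¹) = α δ⁻¹`
    have key : ∀ α β δ (h : 𝓖.src α = 𝓖.rng (𝓖.inv β)) (h' : 𝓖.src β = 𝓖.rng (𝓖.inv δ))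
        (h'' : 𝓖.src α = 𝓖.rng (𝓖.inv δ))
        (hm : 𝓖.src (𝓖.mul ⟨(α, 𝓖.inv β), h⟩) = 𝓖.rng (𝓖.mul ⟨(β, 𝓖.inv δ), h'⟩)),
        𝓖.mul ⟨(𝓖.mul ⟨(α, 𝓖.inv β), h⟩, 𝓖.mul ⟨(β, 𝓖.inv δ), h'⟩), hm⟩ =
          𝓖.mul ⟨(α, 𝓖.inv δ), h''⟩ := by
      intro α β δ h h' h'' hm
      have hb : 𝓖.src (𝓖.inv β) = 𝓖.rng (𝓖.mul ⟨(β, 𝓖.inv δ), h'⟩) :=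
        (𝓖.src_mul ⟨(α, 𝓖.inv β), h⟩).symm.trans hm
      rw [𝓖.mul_assoc α (𝓖.inv β) _ h hb]
      exact 𝓖.mul_congr _ rfl (𝓖.inv_mul_cancel_left _ _ _ _) _
    ext γ
    constructor
    · rintro ⟨⟨⟨a, b⟩, hab⟩, ha, hb, rfl⟩
      obtain ⟨α, hα, β, hβ, h, rfl⟩ := mem_setMul_setInv.1 ha
      obtain ⟨β', hβ', δ, hδ, h', rfl⟩ := mem_setMul_setInv.1 hb
      have hbb : 𝓖.rng β = 𝓖.rng β' := by
        have := hab
        simp only [𝓖.src_mul, 𝓖.rng_mul, 𝓖.src_inv] at this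
        exact this
      obtain rfl := (hT.isBisection j).injOn_rng hβ hβ' hbb
      exact mem_setMul_setInv.2 ⟨α, hα, δ, hδ, h.trans h', key _ _ _ _ _ _ _⟩
    · intro hγ
      obtain ⟨α, hα, δ, hδ, h, rfl⟩ := mem_setMul_setInv.1 hγ
      obtain ⟨β, hβ, hβs⟩ := hT.exists_src_eq (hT.src_mem hα) j
      refine ⟨⟨(𝓖.mul ⟨(α, 𝓖.inv β), ?_⟩, 𝓖.mul ⟨(β, 𝓖.inv δ), ?_⟩), ?_⟩,
        mem_setMul_setInv.2 ⟨α, hα, β, hβ, hβs.symm, rfl⟩,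
        mem_setMul_setInv.2 ⟨β, hβ, δ, hδ, hβs.trans h, rfl⟩, key _ _ _ _ _ _ _⟩
      · rw [𝓖.rng_inv, hβs]
      · rw [𝓖.rng_inv, hβs, h]
      · rw [𝓖.src_mul, 𝓖.rng_mul, 𝓖.src_inv]

section perm

variable [Fintype ι] [T2Space X]

/-- The element of the full group which permutes the ranges of the members of a frame. -/
noncomputable def perm (hT : 𝓖.IsFrame T W) (σ : Equiv.Perm ι) : 𝓖.FullGroup :=
  ⟨_, (hT.comp_injective (Fintype.equivFin ι).symm.injective).isMultisection.isFullBisection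
    ((Fintype.equivFin ι).permCongr σ)⟩

theorem perm_val (hT : 𝓖.IsFrame T W) (σ : Equiv.Perm ι) :
    (hT.perm σ).1 = 𝓖.multisectionPerm (fun i j => 𝓖.setMul (T ((Fintype.equivFin ι).symm i))
      (𝓖.setInv (T ((Fintype.equivFin ι).symm j)))) ((Fintype.equivFin ι).permCongr σ) :=
  rfl

theorem perm_smul_rng (hT : 𝓖.IsFrame T W) {σ : Equiv.Perm ι} {i : ι} {α β : 𝒢}
    (hα : α ∈ T (σ i)) (hβ : β ∈ T i) (h : 𝓖.src α = 𝓖.src β) :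
    hT.perm σ • 𝓖.rng β = 𝓖.rng α := by
  have h1 := IsMultisection.smul_src (hT.perm_val σ) (i := Fintype.equivFin ι i)
    (γ := 𝓖.mul ⟨(α, 𝓖.inv β), h.trans (𝓖.rng_inv β).symm⟩)
    (mem_setMul_setInv.2 ⟨α, by simpa using hα, β, by simpa using hβ, h, rfl⟩)
  rwa [𝓖.src_mul, 𝓖.rng_mul, 𝓖.src_inv] at h1

theorem perm_smul_eq_self (hT : 𝓖.IsFrame T W) (σ : Equiv.Perm ι) {x : X}
    (hx : ∀ i, x ∉ 𝓖.rng '' T i) : hT.perm σ • x = x := by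
  refine IsMultisection.smul_eq_self (hT.perm_val σ) fun i h => ?_
  have h' := (hT.comp_injective (Fintype.equivFin ι).symm.injective).mul_inv_self i
  obtain ⟨y, hy, he⟩ : 𝓖.one x ∈ 𝓖.one '' _ := h' ▸ h
  rw [𝓖.isEmbedding_one.injective he] at hy
  exact hx _ hy

/-- An element of the full group is determined by its effect on a frame. -/
theorem eq_perm (hT : 𝓖.IsFrame T W) (heff : 𝓖.IsEffective) {g : 𝓖.FullGroup} {σ : Equiv.Perm ι}
    (h1 : ∀ i, ∀ α ∈ T (σ i), ∀ β ∈ T i, 𝓖.src α = 𝓖.src β → g • 𝓖.rng β = 𝓖.rng α)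
    (h2 : ∀ x, (∀ i, x ∉ 𝓖.rng '' T i) → g • x = x) : g = hT.perm σ := by
  refine heff.fullGroup_ext fun x => ?_
  by_cases hx : ∀ i, x ∉ 𝓖.rng '' T i
  · rw [h2 x hx, hT.perm_smul_eq_self σ hx]
  · push Not at hx
    obtain ⟨i, β, hβ, rfl⟩ := hx
    obtain ⟨α, hα, hs⟩ := hT.exists_src_eq (hT.src_mem hβ) (σ i)
    rw [h1 i α hα β hβ hs, hT.perm_smul_rng hα hβ hs]

/-- The homomorphism from the symmetric group to the full group defined by a frame. -/
noncomputable def permHom (hT : 𝓖.IsFrame T W) (heff : 𝓖.IsEffective) :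
    Equiv.Perm ι →* 𝓖.FullGroup :=
  MonoidHom.mk' hT.perm fun σ τ => by
    refine (hT.eq_perm heff ?_ ?_).symm
    · intro i α hα β hβ h
      obtain ⟨δ, hδ, hs⟩ := hT.exists_src_eq (hT.src_mem hβ) (τ i)
      rw [mul_smul, hT.perm_smul_rng (σ := τ) hδ hβ hs,
        hT.perm_smul_rng (σ := σ) hα hδ (h.trans hs.symm)]
    · intro x hx
      rw [mul_smul, hT.perm_smul_eq_self τ hx, hT.perm_smul_eq_self σ hx]

theorem perm_mem_alternatingFullGroup [DecidableEq ι] (hT : 𝓖.IsFrame T W)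
    (h3 : 3 ≤ Fintype.card ι) {σ : Equiv.Perm ι} (hσ : σ ∈ alternatingGroup ι) :
    hT.perm σ ∈ 𝓖.alternatingFullGroup := by
  refine Subgroup.subset_closure ⟨Fintype.card ι, h3, _,
    (hT.comp_injective (Fintype.equivFin ι).symm.injective).isMultisection,
    (Fintype.equivFin ι).permCongr σ, ?_, rfl⟩
  rw [Equiv.Perm.mem_alternatingGroup] at hσ ⊢
  rw [Equiv.Perm.sign_permCongr, hσ]

/-- The homomorphism from the alternating group to the alternating full group defined by a
frame. -/
noncomputable def alternatingHom [DecidableEq ι] (hT : 𝓖.IsFrame T W) (heff : 𝓖.IsEffective)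
    (h3 : 3 ≤ Fintype.card ι) : alternatingGroup ι →* 𝓖.alternatingFullGroup :=
  ((hT.permHom heff).comp (alternatingGroup ι).subtype).codRestrict 𝓖.alternatingFullGroup
    fun σ => hT.perm_mem_alternatingFullGroup h3 σ.2

end perm

end IsFrame

namespace IsMultisection

variable {d : ℕ} {F : Fin d → Fin d → Set 𝒢}

theorem isFrame (hF : 𝓖.IsMultisection F) (j : Fin d) :
    𝓖.IsFrame (fun i => F i j) (𝓖.src '' F j j) := by
  have hs : ∀ i, 𝓖.src '' F i j = 𝓖.src '' F j j := by
    intro i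
    ext x
    constructor
    · rintro ⟨γ, h, rfl⟩
      exact ⟨_, hF.one_src_mem h, 𝓖.src_one _⟩
    · rintro ⟨γ, h, rfl⟩
      exact hF.exists_src_eq (hF.one_src_mem h) i
  refine ⟨fun i => hF.isBisection i j, fun i => ?_, hs, fun i l h => ?_⟩
  · have := (hF.isBisection i j).isCompact_inter_preimage
      ((hF.diag_compact j).image 𝓖.isLocalHomeomorph_src.continuous) (hs i).ge
    rwa [← hs i, inter_eq_left.2 (subset_preimage_image _ _)] at this
  · rw [disjoint_left]
    rintro _ ⟨γ, hγ, rfl⟩ ⟨δ, hδ, he⟩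
    exact h (hF.eq_of_mem (hF.one_rng_mem hγ) (he ▸ hF.one_rng_mem hδ))

theorem eq_perm_isFrame [T2Space X] (hF : 𝓖.IsMultisection F) (heff : 𝓖.IsEffective) (j : Fin d)
    {g : 𝓖.FullGroup} {σ : Equiv.Perm (Fin d)} (hg : g.1 = 𝓖.multisectionPerm F σ) :
    g = (hF.isFrame j).perm σ := by
  refine (hF.isFrame j).eq_perm heff ?_ ?_
  · intro i α hα β hβ h
    obtain ⟨γ, hγ, hs⟩ := hF.exists_src_eq (hF.one_rng_mem hβ) (σ i)
    have hm : 𝓖.mul ⟨(γ, β), hs⟩ ∈ F (σ i) j := hF.mul (σ i) i j ▸ ⟨_, hγ, hβ, rfl⟩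
    have he : 𝓖.mul ⟨(γ, β), hs⟩ = α :=
      (hF.isBisection _ _).injOn_src hm hα ((𝓖.src_mul _).trans h.symm)
    rw [← hs, smul_src hg hγ, ← he, 𝓖.rng_mul]
  · intro x hx
    refine smul_eq_self hg fun i h => hx i ?_
    exact hF.exists_rng_eq h j

end IsMultisection

/-- Frames can be prescribed at a point. -/
theorem exists_isFrame [T2Space X] [CompactSpace X] [TotallyDisconnectedSpace X]
    (𝓖 : EtaleGroupoid X 𝒢) {ι : Type*} [Finite ι] {x : X} {a : ι → 𝒢}
    (hsrc : ∀ i, 𝓖.src (a i) = x) (hinj : Function.Injective fun i => 𝓖.rng (a i))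
    {O : ι → Set 𝒢} (hO : ∀ i, IsOpen (O i)) (ha : ∀ i, a i ∈ O i) :
    ∃ (T : ι → Set 𝒢) (W : Set X), 𝓖.IsFrame T W ∧ IsClopen W ∧ x ∈ W ∧
      ∀ i, a i ∈ T i ∧ T i ⊆ O i := by
  obtain ⟨Q, hQ, hQd⟩ := (finite_range fun i => 𝓖.rng (a i)).t2_separation
  choose B hB haB hBO using fun i => 𝓖.exists_isBisection_subset
    ((hO i).inter ((hQ (𝓖.rng (a i))).2.preimage 𝓖.isLocalHomeomorph_rng.continuous))
    ⟨ha i, (hQ (𝓖.rng (a i))).1⟩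
  have hN : IsOpen (⋂ i, 𝓖.src '' B i) := isOpen_iInter_of_finite fun i =>
    𝓖.isLocalHomeomorph_src.isOpenMap _ (hB i).isOpen
  have hxN : x ∈ ⋂ i, 𝓖.src '' B i := mem_iInter.2 fun i => ⟨a i, haB i, hsrc i⟩
  obtain ⟨W, hW, hxW, hWN⟩ := compact_exists_isClopen_in_isOpen hN hxN
  have hWB : ∀ i, W ⊆ 𝓖.src '' B i := fun i => hWN.trans (iInter_subset _ i)
  refine ⟨fun i => B i ∩ 𝓖.src ⁻¹' W, W, ⟨fun i => ?_, fun i => ?_, fun i => ?_, fun i j h => ?_⟩,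
    hW, hxW, fun i => ⟨⟨haB i, ?_⟩, ?_⟩⟩
  · exact (hB i).mono ((hB i).isOpen.inter (hW.2.preimage 𝓖.isLocalHomeomorph_src.continuous))
      inter_subset_left
  · exact (hB i).isCompact_inter_preimage hW.1.isCompact (hWB i)
  · rw [image_inter_preimage, inter_eq_right.2 (hWB i)]
  · refine (hQd ⟨i, rfl⟩ ⟨j, rfl⟩ (hinj.ne h)).mono ?_ ?_
    · rintro _ ⟨γ, hγ, rfl⟩
      exact (hBO i hγ.1).2
    · rintro _ ⟨γ, hγ, rfl⟩
      exact (hBO j hγ.1).2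
  · rw [mem_preimage, hsrc]
    exact hxW
  · exact inter_subset_left.trans ((hBO i).trans inter_subset_left)

/-! ### Local transitivity of the alternating full group -/

section local_transitivity

variable [T2Space X] [CompactSpace X] [TotallyDisconnectedSpace X] [PerfectSpace X]

/-- The source, the range and a third point of the orbit span a frame of degree three. -/
theorem IsMinimal.exists_nhds_smul_src_eq_of_ne (hmin : 𝓖.IsMinimal)
    {γ : 𝒢} (hγ : 𝓖.src γ ≠ 𝓖.rng γ) :
    ∃ V, 𝓖.IsBisection V ∧ γ ∈ V ∧
      ∃ g ∈ 𝓖.alternatingFullGroup, ∀ δ ∈ V, g • 𝓖.src δ = 𝓖.rng δ := by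
  obtain ⟨z, ⟨ε, hε, rfl⟩, hz⟩ := (hmin.infinite_orbit (𝓖.src γ)).exists_notMem_finite
    (toFinite {𝓖.src γ, 𝓖.rng γ})
  simp only [mem_insert_iff, mem_singleton_iff, not_or] at hz
  -- The first member consists of units, so that the three-cycle agrees with the second one on `W`.
  obtain ⟨T, W, hT, -, -, ha⟩ := 𝓖.exists_isFrame (ι := Fin 3) (x := 𝓖.src γ)
    (a := ![𝓖.one (𝓖.src γ), γ, ε]) (O := ![𝓖.unitSet, univ, univ])
    (by intro i; fin_cases i <;> simp [𝓖.src_one, hε])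
    (by
      intro i j h
      fin_cases i <;> fin_cases j <;> simp_all [𝓖.rng_one, eq_comm])
    (by intro i; fin_cases i <;> simp [𝓖.isBisection_unitSet.isOpen])
    (by intro i; fin_cases i <;> simp [unitSet])
  refine ⟨T 1, hT.isBisection 1, (ha 1).1, hT.perm (finRotate 3),
    hT.perm_mem_alternatingFullGroup (by simp) ?_, ?_⟩
  · exact Equiv.Perm.finRotate_bit1_mem_alternatingGroup (n := 1)
  · intro δ hδ
    obtain ⟨β, hβ, hs⟩ := hT.exists_src_eq (hT.src_mem hδ) 0
    obtain ⟨y, rfl⟩ := (ha 0).2 hβ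
    rw [𝓖.src_one] at hs
    subst hs
    have := hT.perm_smul_rng (σ := finRotate 3) (i := 0) hδ hβ (𝓖.src_one _).symm
    rwa [𝓖.rng_one] at this

/-- Locally, every arrow is implemented by an element of the alternating full group. -/
theorem IsMinimal.exists_nhds_smul_src_eq (hmin : 𝓖.IsMinimal) (γ : 𝒢) :
    ∃ V, IsOpen V ∧ γ ∈ V ∧ ∃ g ∈ 𝓖.alternatingFullGroup, ∀ δ ∈ V, g • 𝓖.src δ = 𝓖.rng δ := by
  -- factor `γ` through a third point of its orbit
  obtain ⟨z, ⟨α, hα, rfl⟩, hz⟩ := (hmin.infinite_orbit (𝓖.src γ)).exists_notMem_finite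
    (toFinite {𝓖.src γ, 𝓖.rng γ})
  simp only [mem_insert_iff, mem_singleton_iff, not_or] at hz
  have hγα : 𝓖.src γ = 𝓖.rng (𝓖.inv α) := by rw [𝓖.rng_inv, hα]
  obtain ⟨V₁, hV₁, hαV, g, hg, hgV⟩ :=
    hmin.exists_nhds_smul_src_eq_of_ne (γ := α) (by rw [hα]; exact Ne.symm hz.1)
  obtain ⟨V₂, hV₂, hβV, h, hh, hhV⟩ :=
    hmin.exists_nhds_smul_src_eq_of_ne (γ := 𝓖.mul ⟨(γ, 𝓖.inv α), hγα⟩)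
      (by rw [𝓖.src_mul, 𝓖.rng_mul, 𝓖.src_inv]; exact hz.2)
  refine ⟨𝓖.setMul V₂ V₁, (hV₂.setMul hV₁).isOpen, ?_, h * g, mul_mem hh hg, ?_⟩
  · refine ⟨⟨(_, α), (𝓖.src_mul _).trans (𝓖.src_inv α)⟩, hβV, hαV, ?_⟩
    rw [𝓖.mul_assoc γ (𝓖.inv α) α hγα (𝓖.src_inv α)]
    exact (𝓖.mul_congr _ rfl ((𝓖.inv_mul α).trans (congrArg _ hα)) (𝓖.rng_one _).symm).trans
      (𝓖.mul_one γ)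
  · rintro _ ⟨⟨⟨β', α'⟩, hc⟩, hβ', hα', rfl⟩
    rw [𝓖.src_mul, 𝓖.rng_mul, mul_smul, hgV _ hα', ← hc, hhV _ hβ']

theorem IsMinimal.exists_finite_smul_src_eq (hmin : 𝓖.IsMinimal) {K : Set 𝒢} (hK : IsCompact K) :
    ∃ S : Set 𝓖.FullGroup, S.Finite ∧ S ⊆ 𝓖.alternatingFullGroup ∧
      ∀ γ ∈ K, ∃ g ∈ S, g • 𝓖.src γ = 𝓖.rng γ := by
  choose V hV hγV g hg hgV using hmin.exists_nhds_smul_src_eq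
  obtain ⟨t, -, ht⟩ := hK.elim_nhds_subcover V fun γ _ => (hV γ).mem_nhds (hγV γ)
  refine ⟨g '' t, t.finite_toSet.image g, ?_, fun γ hγ => ?_⟩
  · rintro _ ⟨γ, -, rfl⟩
    exact hg γ
  · obtain ⟨δ, hδ, h⟩ := mem_iUnion₂.1 (ht hγ)
    exact ⟨g δ, ⟨δ, hδ, rfl⟩, hgV δ γ h⟩

theorem IsMinimal.exists_smul_eq (hmin : 𝓖.IsMinimal) {x y : X} (h : y ∈ 𝓖.orbit x) :
    ∃ g ∈ 𝓖.alternatingFullGroup, g • x = y := by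
  obtain ⟨γ, rfl, rfl⟩ := h
  obtain ⟨V, -, hγ, g, hg, hgV⟩ := hmin.exists_nhds_smul_src_eq γ
  exact ⟨g, hg, hgV γ hγ⟩

end local_transitivity

/-! ### Normal closures of local alternating groups -/

namespace IsFrame

variable {ι : Type*} {T : ι → Set 𝒢} {W : Set X}

theorem rng_notMem_of_ne (hT : 𝓖.IsFrame T W) {i j : ι} {β : 𝒢} (hβ : β ∈ T i) (h : i ≠ j) :
    𝓖.rng β ∉ 𝓖.rng '' T j :=
  disjoint_left.1 (hT.disjoint i j h) ⟨β, hβ, rfl⟩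

variable [T2Space X] [Fintype ι]

theorem perm_congr {T' : ι → Set 𝒢} (hT : 𝓖.IsFrame T W) (hT' : 𝓖.IsFrame T' W) (h : T = T')
    (σ : Equiv.Perm ι) : hT.perm σ = hT'.perm σ := by
  subst h; rfl

/-- Permutations of the members of a subframe. -/
theorem perm_comp_injective {κ : Type*} [Fintype κ] (hT : 𝓖.IsFrame T W) (heff : 𝓖.IsEffective)
    {f : κ → ι} (hf : Function.Injective f) {σ : Equiv.Perm κ} {σ' : Equiv.Perm ι}
    (h1 : ∀ k, σ' (f k) = f (σ k)) (h2 : ∀ i, i ∉ range f → σ' i = i) :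
    (hT.comp_injective hf).perm σ = hT.perm σ' := by
  refine hT.eq_perm heff ?_ ?_
  · intro i α hα β hβ h
    by_cases hi : i ∈ range f
    · obtain ⟨k, rfl⟩ := hi
      rw [h1] at hα
      exact (hT.comp_injective hf).perm_smul_rng hα hβ h
    · rw [h2 i hi] at hα
      obtain rfl := (hT.isBisection i).injOn_src hα hβ h
      exact (hT.comp_injective hf).perm_smul_eq_self _ fun k =>
        hT.rng_notMem_of_ne hβ fun hik => hi ⟨k, hik.symm⟩
  · exact fun x hx => (hT.comp_injective hf).perm_smul_eq_self _ fun k => hx (f k)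

/-- The restriction of a frame to a disjoint union. -/
theorem perm_restrict_union (hT : 𝓖.IsFrame T W) (heff : 𝓖.IsEffective) {V V₁ V₂ : Set X}
    (hV : IsOpen V) (hVc : IsCompact V) (hVW : V ⊆ W)
    (hV₁ : IsOpen V₁) (hV₁c : IsCompact V₁) (hV₁W : V₁ ⊆ W)
    (hV₂ : IsOpen V₂) (hV₂c : IsCompact V₂) (hV₂W : V₂ ⊆ W)
    (hu : V = V₁ ∪ V₂) (hd : Disjoint V₁ V₂) (σ : Equiv.Perm ι) :
    (hT.restrict hV₁ hV₁c hV₁W).perm σ * (hT.restrict hV₂ hV₂c hV₂W).perm σ =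
      (hT.restrict hV hVc hVW).perm σ := by
  have key : ∀ (V' : Set X) (hV' : IsOpen V') (hc : IsCompact V') (hW : V' ⊆ W) (i : ι),
      ∀ β ∈ T i, 𝓖.src β ∉ V' → (hT.restrict hV' hc hW).perm σ • 𝓖.rng β = 𝓖.rng β := by
    intro V' hV' hc hW i β hβ hβV
    refine (hT.restrict hV' hc hW).perm_smul_eq_self _ fun j => ?_
    rintro ⟨δ, ⟨hδ, hδV⟩, he⟩
    by_cases hij : i = j
    · subst hij
      obtain rfl := (hT.isBisection i).injOn_rng hδ hβ he
      exact hβV hδV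
    · exact hT.rng_notMem_of_ne hβ hij ⟨δ, hδ, he⟩
  subst hu
  refine (hT.restrict hV hVc hVW).eq_perm heff ?_ ?_
  · rintro i α ⟨hα, hαV⟩ β ⟨hβ, hβV⟩ h
    have hs : ∀ V' : Set X, 𝓖.src β ∈ V' → 𝓖.src α ∈ V' := fun V' hV' => by rwa [h]
    rw [mul_smul]
    rcases hβV with hβV | hβV
    · rw [key V₂ hV₂ hV₂c hV₂W i β hβ (disjoint_left.1 hd hβV)]
      exact (hT.restrict hV₁ hV₁c hV₁W).perm_smul_rng ⟨hα, hs _ hβV⟩ ⟨hβ, hβV⟩ h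
    · rw [(hT.restrict hV₂ hV₂c hV₂W).perm_smul_rng ⟨hα, hs _ hβV⟩ ⟨hβ, hβV⟩ h]
      exact key V₁ hV₁ hV₁c hV₁W _ α hα (h ▸ disjoint_right.1 hd hβV)
  · intro x hx
    have h₂ := (hT.restrict hV₂ hV₂c hV₂W).perm_smul_eq_self σ (x := x) fun i => by
      rintro ⟨β, hβ, rfl⟩
      exact hx i ⟨β, ⟨hβ.1, Or.inr hβ.2⟩, rfl⟩
    rw [mul_smul, h₂]
    refine perm_smul_eq_self _ σ fun i => ?_
    rintro ⟨β, hβ, rfl⟩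
    exact hx i ⟨β, ⟨hβ.1, Or.inl hβ.2⟩, rfl⟩

end IsFrame

/-- A normal subgroup which contains the alternating groups of all frames of a fixed degree inside
some open set contains the whole alternating full group.

At a point, a given multisection extends to a frame with additional members inside the open set,
whose alternating group is simple and meets the normal subgroup. -/
theorem IsMinimal.alternatingFullGroup_le [T2Space X] [CompactSpace X]
    [TotallyDisconnectedSpace X] [PerfectSpace X] (hmin : 𝓖.IsMinimal) (heff : 𝓖.IsEffective)
    {N : Subgroup 𝓖.FullGroup} (hN : ∀ a ∈ 𝓖.alternatingFullGroup, ∀ n ∈ N, a * n * a⁻¹ ∈ N)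
    {U : Set X} (hU : IsOpen U) (hUne : U.Nonempty) {d : ℕ} (hd : 5 ≤ d)
    (h : ∀ (T : Fin d → Set 𝒢) (W : Set X) (hT : 𝓖.IsFrame T W), (∀ i, 𝓖.rng '' T i ⊆ U) →
      ∀ σ ∈ alternatingGroup (Fin d), hT.perm σ ∈ N) :
    𝓖.alternatingFullGroup ≤ N := by
  refine (Subgroup.closure_le N).2 ?_
  rintro g ⟨e, he, F, hF, σ, hσ, hg⟩
  obtain ⟨j⟩ : Nonempty (Fin e) := ⟨⟨0, by omega⟩⟩
  have hT := hF.isFrame j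
  set W := 𝓖.src '' F j j with hW
  have hWo : IsOpen W := hT.isOpen_base j
  have hWc : IsCompact W := hT.isCompact_base j
  suffices hp : ∃ C, IsClopen C ∧ W ⊆ C ∧ ∀ (V : Set X) (hV : IsOpen V) (hVc : IsCompact V)
      (hVW : V ⊆ W), V ⊆ C → (hT.restrict hV hVc hVW).perm σ ∈ N by
    obtain ⟨C, -, hWC, hC⟩ := hp
    have := hC W hWo hWc subset_rfl hWC
    rw [hF.eq_perm_isFrame heff j hg]
    rwa [IsFrame.perm_congr hT (hT.restrict hWo hWc subset_rfl)]
    funext i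
    exact (inter_eq_left.2 fun γ hγ => hT.src_mem hγ).symm
  -- The claim passes from two clopen sets to their union, and it holds near every point of `W`.
  refine hWc.induction_on (p := fun s => ∃ C, IsClopen C ∧ s ⊆ C ∧ ∀ (V : Set X) (hV : IsOpen V)
      (hVc : IsCompact V) (hVW : V ⊆ W), V ⊆ C → (hT.restrict hV hVc hVW).perm σ ∈ N) ?_ ?_ ?_ ?_
  · refine ⟨∅, isClopen_empty, subset_rfl, fun V hV hVc hVW hVe => ?_⟩
    convert N.one_mem
    refine heff.fullGroup_ext fun x => ?_
    rw [one_smul]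
    refine IsFrame.perm_smul_eq_self _ _ ?_
    rintro i ⟨γ, hγ, -⟩
    exact hVe hγ.2
  · rintro s t hst ⟨C, h1, h2, h3⟩
    exact ⟨C, h1, hst.trans h2, h3⟩
  · rintro s t ⟨C, h1, h2, h3⟩ ⟨C', h1', h2', h3'⟩
    refine ⟨C ∪ C', h1.union h1', union_subset_union h2 h2', fun V hV hVc hVW hVC => ?_⟩
    have hV₁ := hV.inter h1.2
    have hV₁c := hVc.inter_right h1.1
    have hV₁W := (inter_subset_left (t := C)).trans hVW
    have hV₂ := hV.sdiff h1.1
    have hV₂c := hVc.diff h1.2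
    have hV₂W := (sdiff_subset (t := C)).trans hVW
    rw [← hT.perm_restrict_union heff hV hVc hVW hV₁ hV₁c hV₁W hV₂ hV₂c hV₂W
      (inter_union_sdiff V C).symm (disjoint_left.2 fun x hx hx' => hx'.2 hx.2)]
    exact N.mul_mem (h3 _ hV₁ hV₁c hV₁W inter_subset_right)
      (h3' _ hV₂ hV₂c hV₂W fun x hx => (hVC hx.1).resolve_left hx.2)
  · intro y hy
    -- the branches of `F` at `y`, and `d` further points of the orbit of `y` in `U`
    choose a ha has using fun i => hT.exists_src_eq hy i
    have hinj : Function.Injective fun i => 𝓖.rng (a i) := by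
      intro i l hil
      by_contra hne
      exact hT.rng_notMem_of_ne (ha i) hne ⟨a l, ha l, hil.symm⟩
    have hinf : ((𝓖.orbit y ∩ U) \ range fun i => 𝓖.rng (a i)).Infinite :=
      (hmin.infinite_orbit_inter y hU hUne).sdiff (finite_range _)
    let f := hinf.natEmbedding
    choose b hbs hbr using fun k : Fin d => (f k).2.1.1
    obtain ⟨T', W', hT', hW', hyW', hTO⟩ := 𝓖.exists_isFrame (ι := Fin e ⊕ Fin d) (x := y)
      (a := Sum.elim a b) (O := Sum.elim (fun i => F i j) fun _ => 𝓖.rng ⁻¹' U)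
      (by rintro (i | k); exacts [has i, hbs k])
      (by
        rintro (i | k) (i' | k') hh
        · exact congrArg Sum.inl (hinj hh)
        · exact ((f k').2.2 ⟨i, hh.trans (hbr k')⟩).elim
        · exact ((f k).2.2 ⟨i', hh.symm.trans (hbr k)⟩).elim
        · have : f k = f k' := Subtype.ext ((hbr k).symm.trans (hh.trans (hbr k')))
          exact congrArg Sum.inr (Fin.ext (f.injective this)))
      (by
        rintro (i | k)
        exacts [(hF.isBisection i j).isOpen, hU.preimage 𝓖.isLocalHomeomorph_rng.continuous])
      (by
        rintro (i | k)
        exacts [ha i, show 𝓖.rng (b k) ∈ U from hbr k ▸ (f k).2.1.2])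
    refine ⟨W', mem_nhdsWithin_of_mem_nhds (hW'.2.mem_nhds hyW'), W', hW', subset_rfl,
      fun V hV hVc hVW hVW' => ?_⟩
    have hR := hT'.restrict hV hVc hVW'
    set R := fun i => T' i ∩ 𝓖.src ⁻¹' V with hRdef
    have hcard : Nat.card (Fin e ⊕ Fin d) = e + d := by simp
    -- the elements of the alternating group of the large frame which lie in `N`
    let M : Subgroup (alternatingGroup (Fin e ⊕ Fin d)) :=
      N.comap ((hR.permHom heff).comp (alternatingGroup (Fin e ⊕ Fin d)).subtype)
    have hMmem : ∀ τ, τ ∈ M ↔ hR.perm τ.1 ∈ N := fun _ => Iff.rfl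
    have : M.Normal := by
      refine ⟨fun n hn τ => ?_⟩
      have h1 := hN _ (hR.perm_mem_alternatingFullGroup (by simp; omega) τ.2) _ hn
      change hR.permHom heff τ.1 * hR.permHom heff n.1 * (hR.permHom heff τ.1)⁻¹ ∈ N at h1
      rw [← map_mul, ← map_inv, ← map_mul] at h1
      exact h1
    have hMtop : M = ⊤ := by
      refine (alternatingGroup.normal_subgroup_eq_bot_or_eq_top (by omega) (N := M)).resolve_left ?_
      intro hbot
      have : Nontrivial (alternatingGroup (Fin d)) :=
        alternatingGroup.nontrivial_of_three_le_card (by simp; omega)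
      obtain ⟨τ, hτ⟩ := exists_ne (1 : alternatingGroup (Fin d))
      have hτ' : Equiv.Perm.sumCongr 1 τ.1 ∈ alternatingGroup (Fin e ⊕ Fin d) := by
        rw [Equiv.Perm.mem_alternatingGroup, Equiv.Perm.sign_sumCongr,
          Equiv.Perm.mem_alternatingGroup.1 τ.2]
        simp
      have hmem : (⟨_, hτ'⟩ : alternatingGroup (Fin e ⊕ Fin d)) ∈ M := by
        rw [hMmem, ← hR.perm_comp_injective heff Sum.inr_injective (σ := τ.1) (by simp) (by simp)]
        refine h _ _ _ ?_ _ τ.2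
        rintro k _ ⟨γ, hγ, rfl⟩
        exact (hTO (Sum.inr k)).2 hγ.1
      rw [hbot, Subgroup.mem_bot, Subtype.ext_iff] at hmem
      refine hτ (Subtype.ext (Equiv.ext fun k => ?_))
      have := Equiv.congr_fun hmem (Sum.inr k)
      simpa using this
    have hσ' : Equiv.Perm.sumCongr σ 1 ∈ alternatingGroup (Fin e ⊕ Fin d) := by
      rw [Equiv.Perm.mem_alternatingGroup, Equiv.Perm.sign_sumCongr,
        Equiv.Perm.mem_alternatingGroup.1 hσ]
      simp
    have hmem : (⟨_, hσ'⟩ : alternatingGroup (Fin e ⊕ Fin d)) ∈ M := hMtop ▸ Subgroup.mem_top _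
    rw [hMmem, ← hR.perm_comp_injective heff Sum.inl_injective (σ := σ) (by simp) (by simp)] at hmem
    rwa [IsFrame.perm_congr (hT.restrict hV hVc hVW) (hR.comp_injective Sum.inl_injective)]
    funext i
    refine Subset.antisymm ?_ ?_
    · rintro γ ⟨hγ, hγV⟩
      obtain ⟨δ, hδ, hs⟩ := hR.exists_src_eq hγV (Sum.inl i)
      rwa [← (hF.isBisection i j).injOn_src ((hTO (Sum.inl i)).2 hδ.1) hγ hs]
    · rintro γ ⟨hγ, hγV⟩
      exact ⟨(hTO (Sum.inl i)).2 hγ, hγV⟩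

/-! ### Actions of the alternating full group -/

theorem IsEffective.commute_of_disjoint (heff : 𝓖.IsEffective) {a b : 𝓖.FullGroup} {P Q : Set X}
    (ha : ∀ x, x ∉ P → a • x = x) (hb : ∀ x, x ∉ Q → b • x = x) (hPQ : Disjoint P Q) :
    Commute a b := by
  refine heff.fullGroup_ext fun x => ?_
  rw [mul_smul, mul_smul]
  by_cases hx : x ∈ P
  · rw [hb x (disjoint_left.1 hPQ hx)]
    by_cases hax : a • x ∈ P
    · rw [hb _ (disjoint_left.1 hPQ hax)]
    · have h : a • x = x := MulAction.injective a (ha _ hax)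
      rw [h, hb x (disjoint_left.1 hPQ hx)]
  · rw [ha x hx]
    by_cases hbx : b • x ∈ P
    · have h : b • x = x := MulAction.injective b (hb _ (disjoint_left.1 hPQ hbx))
      rw [h, ha x hx]
    · rw [ha _ hbx]

/-- Let the elements `wᵢ` have distinct values at a unit `x`. If the alternating full group acts
nontrivially, then there is a point under which no three of the `wᵢ` coincide.

Otherwise the alternating groups of high degree in a neighbourhood of `x` with pairwise disjoint
translates by the `wᵢ` act trivially by `le_ker_of_forall_three_coincidences`. -/
theorem IsMinimal.eq_one_of_forall_three_coincidences [T2Space X] [CompactSpace X]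
    [TotallyDisconnectedSpace X] [PerfectSpace X] (hmin : 𝓖.IsMinimal) (heff : 𝓖.IsEffective)
    {Γ I : Type*} [Fintype I] (ρ : 𝓖.alternatingFullGroup →* Equiv.Perm Γ)
    (w : I → 𝓖.alternatingFullGroup) {x : X}
    (hw : Function.Injective fun i => (w i : 𝓖.FullGroup) • x)
    (hcoin : ∀ u : Γ, ∃ i j k, i ≠ j ∧ i ≠ k ∧ j ≠ k ∧ ρ (w i) u = ρ (w j) u ∧
      ρ (w i) u = ρ (w k) u) : ρ = 1 := by
  obtain ⟨Q, hQ, hQd⟩ := (finite_range fun i => (w i : 𝓖.FullGroup) • x).t2_separation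
  set U : Set X := ⋂ i, (fun y => (w i : 𝓖.FullGroup) • y) ⁻¹' Q ((w i : 𝓖.FullGroup) • x)
  have hU : IsOpen U := isOpen_iInter_of_finite fun i =>
    (hQ _).2.preimage (w i : 𝓖.FullGroup).continuous_smul
  have hxU : x ∈ U := mem_iInter.2 fun i => (hQ _).1
  -- In this degree alternating groups are perfect, and have no proper subgroup of index at most
  -- `|I| ^ 3`.
  have hle := hmin.alternatingFullGroup_le heff (N := ρ.ker.map 𝓖.alternatingFullGroup.subtype)
    ?_ hU ⟨x, hxU⟩ (d := Fintype.card I ^ 3 + 5) (by omega) ?_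
  · ext1 g
    obtain ⟨g', hg', he⟩ := hle g.2
    rwa [Subtype.ext he] at hg'
  · rintro a ha _ ⟨n, hn, rfl⟩
    exact ⟨⟨a, ha⟩ * n * ⟨a, ha⟩⁻¹, ρ.normal_ker.conj_mem n hn ⟨a, ha⟩, rfl⟩
  · intro T W hT hTU σ hσ
    have hfix : ∀ (i : I) (τ : alternatingGroup (Fin (Fintype.card I ^ 3 + 5))) (y : X),
        y ∉ Q ((w i : 𝓖.FullGroup) • x) →
        ((w i : 𝓖.FullGroup) * hT.perm τ.1 * (w i : 𝓖.FullGroup)⁻¹) • y = y := by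
      intro i τ y hy
      rw [mul_smul, mul_smul, hT.perm_smul_eq_self, smul_inv_smul]
      intro k hk
      have := mem_iInter.1 (hTU k hk) i
      rw [mem_preimage, smul_inv_smul] at this
      exact hy this
    have h := le_ker_of_forall_three_coincidences ρ (hT.alternatingHom heff (by simp)) w
      (fun i j hij a b => Subtype.ext <| heff.commute_of_disjoint (hfix i a) (hfix j b)
        (hQd ⟨i, rfl⟩ ⟨j, rfl⟩ (hw.ne hij)))
      (commutator_alternatingGroup_eq_top (by simp))
      (fun K hK => alternatingGroup_eq_top_of_index_add_three_le (by simp) K (by simp; omega))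
      hcoin
    exact ⟨_, h ⟨⟨σ, hσ⟩, rfl⟩, rfl⟩

/-! ### Balls in the orbits -/

/-- The units which are reached from `x` by at most `n` applications of members of `𝒯`. -/
def stepBall (𝓖 : EtaleGroupoid X 𝒢) (𝒯 : Set (Set 𝒢)) : ℕ → X → Set X
  | 0, x => {x}
  | n + 1, x => 𝓖.stepBall 𝒯 n x ∪
      {z | ∃ T ∈ 𝒯, ∃ γ ∈ T, 𝓖.src γ ∈ 𝓖.stepBall 𝒯 n x ∧ 𝓖.rng γ = z}

/-- A nontrivial action of the alternating full group on a metric space of bounded geometry by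
permutations of bounded displacement forces the space to grow as fast as the orbits. -/
theorem IsMinimal.eq_one_of_not_growthLE [T2Space X] [CompactSpace X]
    [TotallyDisconnectedSpace X] [PerfectSpace X] (hmin : 𝓖.IsMinimal) (heff : 𝓖.IsEffective)
    {𝒯 : Set (Set 𝒢)} (h𝒯 : 𝓖.IsGeneratingSet 𝒯) {Γ : Type w} [MetricSpace Γ]
    (hΓ : BoundedGeometry Γ)
    (hgrowth : ¬ GrowthLE (fun n => ⨆ x, (𝓖.stepBall 𝒯 n x).encard) (uniformGrowth Γ))
    (ρ : 𝓖.alternatingFullGroup →* wobblingGroup Γ) : ρ = 1 := by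
  classical
  obtain ⟨S, hS, hSA, hS𝒯⟩ := hmin.exists_finite_smul_src_eq
    (h𝒯.finite.isCompact_sUnion h𝒯.isCompact)
  choose D hD using fun g : 𝓖.alternatingFullGroup => (ρ g).2
  obtain ⟨L, hL⟩ : ∃ L : ℕ, ∀ g : 𝓖.alternatingFullGroup, (g : 𝓖.FullGroup) ∈ S →
      ∀ v, dist v ((ρ g).1 v) ≤ L := by
    have hfin : (D '' (Subtype.val ⁻¹' S)).Finite :=
      (hS.preimage Subtype.val_injective.injOn).image D
    obtain ⟨M, hM⟩ := hfin.bddAbove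
    obtain ⟨L, hL⟩ := exists_nat_ge M
    exact ⟨L, fun g hg v => (hD g v).trans ((hM ⟨g, hg, rfl⟩).trans hL)⟩
  have hstep : ∀ n x, ∀ z ∈ 𝓖.stepBall 𝒯 n x, ∃ g : 𝓖.alternatingFullGroup,
      (g : 𝓖.FullGroup) • x = z ∧ ∀ v, dist v ((ρ g).1 v) ≤ L * n := by
    intro n x
    induction n with
    | zero =>
      rintro z rfl
      exact ⟨1, one_smul _ _, fun v => by simp⟩
    | succ n ih =>
      rintro z (hz | ⟨T, hT, γ, hγ, hs, rfl⟩)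
      · obtain ⟨g, hg, hd⟩ := ih z hz
        refine ⟨g, hg, fun v => (hd v).trans ?_⟩
        gcongr
        omega
      · obtain ⟨g, hg, hd⟩ := ih _ hs
        obtain ⟨s, hs, he⟩ := hS𝒯 γ (mem_sUnion_of_mem hγ hT)
        refine ⟨⟨s, hSA hs⟩ * g, ?_, fun v => ?_⟩
        · rw [← he, ← hg]
          exact mul_smul _ _ _
        · rw [map_mul]
          refine (dist_triangle v ((ρ g).1 v) _).trans ?_
          have := hL ⟨s, hSA hs⟩ hs ((ρ g).1 v)
          push_cast
          rw [mul_add, _root_.mul_one]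
          exact add_le_add (hd v) this
  -- In the constant `L + 2`, `L` accounts for the displacement and `2` for coinciding values.
  obtain ⟨n, hn⟩ : ∃ n, ((L + 2 : ℕ) : ℕ∞) * uniformGrowth Γ ((L + 2) * n) <
      ⨆ x, (𝓖.stepBall 𝒯 n x).encard := by
    by_contra! h
    exact hgrowth ⟨L + 2, by omega, h⟩
  obtain ⟨x, hx⟩ := lt_iSup_iff.1 hn
  obtain ⟨m, hm⟩ := ENat.ne_top_iff_exists.1 (hΓ ((L + 2) * n)).ne
  rw [← hm] at hx
  obtain ⟨t, htx, ht⟩ := exists_subset_encard_eq (s := 𝓖.stepBall 𝒯 n x)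
    (k := (((L + 2) * m + 1 : ℕ) : ℕ∞)) (by
      push_cast at hx ⊢
      exact Order.add_one_le_of_lt hx)
  have htf : t.Finite := finite_of_encard_eq_coe ht
  have : Fintype t := htf.fintype
  have hcard : Fintype.card t = (L + 2) * m + 1 := by
    rw [← Nat.card_eq_fintype_card, Nat.card_coe_set_eq, ncard_def, ht, ENat.toNat_natCast]
  choose w hwx hwd using fun i : t => hstep n x i (htx i.2)
  suffices h : (wobblingGroup Γ).subtype.comp ρ = 1 by
    ext1 g
    exact Subtype.ext (DFunLike.congr_fun h g)
  refine hmin.eq_one_of_forall_three_coincidences heff _ w (x := x) ?_ fun u => ?_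
  · intro i j hij
    exact Subtype.ext ((hwx i).symm.trans (hij.trans (hwx j)))
  · -- If at most two of the values coincide, at least half as many values as there are elements
    -- of `t` lie in the ball of radius `(L + 2) n` around `u`.
    by_contra! hu
    have h2 := Finset.card_le_mul_card_image (f := fun i => (ρ (w i)).1 u)
      (Finset.univ : Finset t) 2 (by
        intro b _
        by_contra! h3
        obtain ⟨i, hi, j, hj, k, hk, hij, hik, hjk⟩ := Finset.two_lt_card.1 h3
        simp only [Finset.mem_filter, Finset.mem_univ, true_and] at hi hj hk
        exact hu i j k hij hik hjk (hi.trans hj.symm) (hi.trans hk.symm))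
    have h3 : ((Finset.univ.image fun i => (ρ (w i)).1 u).card : ℕ∞) ≤ m := by
      rw [hm, ← encard_coe_eq_coe_finsetCard]
      refine (encard_le_encard ?_).trans
        (le_iSup (fun v : Γ => (Metric.closedBall v (((L + 2) * n : ℕ) : ℝ)).encard) u)
      intro v hv
      simp only [Finset.coe_image, Finset.coe_univ, image_univ, mem_range] at hv
      obtain ⟨i, rfl⟩ := hv
      rw [Metric.mem_closedBall, dist_comm]
      refine (hwd i u).trans ?_
      push_cast
      gcongr
      linarith
    rw [Nat.cast_le] at h3
    rw [Finset.card_univ, hcard] at h2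
    nlinarith [Nat.zero_le (L * m)]

end EtaleGroupoid

namespace EtaleGroupoid

variable {X : Type u} {𝒢 : Type v} [TopologicalSpace X] [TopologicalSpace 𝒢]
  {𝓖 : EtaleGroupoid X 𝒢} {𝒯 : Set (Set 𝒢)}

theorem stepBall_subset_succ (𝒯 : Set (Set 𝒢)) (n : ℕ) (x : X) :
    𝓖.stepBall 𝒯 n x ⊆ 𝓖.stepBall 𝒯 (n + 1) x :=
  subset_union_left

theorem stepBall_mono (𝒯 : Set (Set 𝒢)) (x : X) : Monotone fun n => 𝓖.stepBall 𝒯 n x :=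
  monotone_nat_of_le_succ fun n => stepBall_subset_succ 𝒯 n x

theorem stepBall_subset_orbit (n : ℕ) {x y : X} (hy : y ∈ 𝓖.orbit x) :
    𝓖.stepBall 𝒯 n y ⊆ 𝓖.orbit x := by
  induction n with
  | zero =>
    rintro _ rfl
    exact hy
  | succ n ih =>
    rintro z (hz | ⟨T, -, γ, -, hs, rfl⟩)
    · exact ih hz
    · exact rng_mem_orbit (ih hs)

theorem mem_stepBall_iff (h𝒯 : 𝓖.IsGeneratingSet 𝒯) {x : X} (n : ℕ) (y z : 𝓖.orbit x) :
    (z : X) ∈ 𝓖.stepBall 𝒯 n y ↔ (𝓖.orbitalGraph 𝒯 x).edist y z ≤ n := by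
  constructor
  · induction n generalizing z with
    | zero =>
      intro h
      rw [Subtype.ext h]
      simp
    | succ n ih =>
      rintro (h | ⟨T, hT, γ, hγ, hs, hr⟩)
      · exact (ih z h).trans (by gcongr; omega)
      · have h1 := ih ⟨_, stepBall_subset_orbit n y.2 hs⟩ hs
        refine (SimpleGraph.edist_triangle (v := ⟨_, stepBall_subset_orbit n y.2 hs⟩)).trans ?_
        push_cast
        refine add_le_add h1 (SimpleGraph.edist_le_one_iff_adj_or_eq.2 ?_)
        by_cases he : (⟨_, stepBall_subset_orbit n y.2 hs⟩ : 𝓖.orbit x) = z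
        · exact Or.inr he
        · exact Or.inl ⟨he, Or.inl ⟨T, hT, γ, hγ, rfl, hr⟩⟩
  · intro h
    obtain ⟨p, hp⟩ := (𝓖.orbitalGraph_connected h𝒯 x).exists_walk_length_eq_edist z y
    have key : ∀ (a b : 𝓖.orbit x) (p : (𝓖.orbitalGraph 𝒯 x).Walk a b),
        (a : X) ∈ 𝓖.stepBall 𝒯 p.length b := by
      intro a b p
      induction p with
      | nil => exact rfl
      | cons hadj p ih =>
        refine Or.inr ?_
        obtain ⟨-, ⟨T, hT, γ, hγ, hs, hr⟩ | ⟨T, hT, γ, hγ, hs, hr⟩⟩ := hadj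
        · exact ⟨_, h𝒯.symm T hT, 𝓖.inv γ, ⟨γ, hγ, rfl⟩, by rwa [𝓖.src_inv, hr], by
            rw [𝓖.rng_inv, hs]⟩
        · exact ⟨T, hT, γ, hγ, by rwa [hs], hr⟩
    rw [SimpleGraph.edist_comm, ← hp, Nat.cast_le] at h
    exact stepBall_mono 𝒯 _ h (key z y p)

theorem encard_edist_le (h𝒯 : 𝓖.IsGeneratingSet 𝒯) {x : X} (n : ℕ) (y : 𝓖.orbit x) :
    {z | (𝓖.orbitalGraph 𝒯 x).edist y z ≤ n}.encard = (𝓖.stepBall 𝒯 n y).encard := by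
  rw [← Subtype.val_injective.encard_image]
  congr 1
  ext z
  constructor
  · rintro ⟨z, hz, rfl⟩
    exact (mem_stepBall_iff h𝒯 n y z).2 hz
  · intro hz
    exact ⟨⟨z, stepBall_subset_orbit n y.2 hz⟩, (mem_stepBall_iff h𝒯 n y ⟨z, _⟩).1 hz, rfl⟩

theorem orbitalGrowth_eq (h𝒯 : 𝓖.IsGeneratingSet 𝒯) :
    𝓖.orbitalGrowth 𝒯 = fun n => ⨆ x, (𝓖.stepBall 𝒯 n x).encard := by
  funext n
  exact iSup_congr fun x => encard_edist_le h𝒯 n ⟨x, 𝓖.mem_orbit_self x⟩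

theorem dist_le_iff (h𝒯 : 𝓖.IsGeneratingSet 𝒯) {x : X} (y z : 𝓖.OrbitalSpace h𝒯 x) (n : ℕ) :
    dist y z ≤ n ↔ z.toUnit ∈ 𝓖.stepBall 𝒯 n y.toUnit := by
  have h1 : dist y z = ((𝓖.orbitalGraph 𝒯 x).dist (V := 𝓖.orbit x) y z : ℝ) := rfl
  refine Iff.trans ?_ (mem_stepBall_iff h𝒯 n (x := x) y z).symm
  rw [h1, Nat.cast_le, ← ((𝓖.orbitalGraph_connected h𝒯 x) y z).coe_dist_eq_edist, Nat.cast_le]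

theorem uniformGrowth_orbitalSpace (h𝒯 : 𝓖.IsGeneratingSet 𝒯) (x : X) (n : ℕ) :
    uniformGrowth (𝓖.OrbitalSpace h𝒯 x) n = ⨆ y : 𝓖.orbit x, (𝓖.stepBall 𝒯 n y).encard := by
  refine iSup_congr fun y => ?_
  rw [← encard_edist_le h𝒯 n (x := x) y]
  congr 1
  ext z
  rw [Metric.mem_closedBall, dist_comm, dist_le_iff]
  exact mem_stepBall_iff h𝒯 n (x := x) y z

/-! ### Bounds for the orbital growth -/

theorem encard_stepBall_le (h𝒯 : 𝓖.IsGeneratingSet 𝒯) (n : ℕ) (x : X) :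
    (𝓖.stepBall 𝒯 n x).encard ≤ (((h𝒯.finite.toFinset.card + 1) ^ n : ℕ) : ℕ∞) := by
  induction n with
  | zero => simp [stepBall]
  | succ n ih =>
    set B := 𝓖.stepBall 𝒯 n x
    have hT : ∀ T ∈ h𝒯.finite.toFinset, (𝓖.rng '' (T ∩ 𝓖.src ⁻¹' B)).encard ≤ B.encard := by
      intro T hT
      refine (encard_image_le _ _).trans (encard_le_encard_of_injOn (f := 𝓖.src) (fun γ hγ => hγ.2)
        ((h𝒯.isBisection T (h𝒯.finite.mem_toFinset.1 hT)).injOn_src.mono inter_subset_left))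
    have hsub : 𝓖.stepBall 𝒯 (n + 1) x ⊆
        B ∪ ⋃ T ∈ h𝒯.finite.toFinset, 𝓖.rng '' (T ∩ 𝓖.src ⁻¹' B) := by
      refine union_subset_union_right _ ?_
      rintro _ ⟨T, hT, γ, hγ, hs, rfl⟩
      exact mem_biUnion (h𝒯.finite.mem_toFinset.2 hT) ⟨γ, ⟨hγ, hs⟩, rfl⟩
    calc (𝓖.stepBall 𝒯 (n + 1) x).encard
        ≤ B.encard + ∑ T ∈ h𝒯.finite.toFinset, (𝓖.rng '' (T ∩ 𝓖.src ⁻¹' B)).encard :=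
          (encard_le_encard hsub).trans ((encard_union_le _ _).trans
            (add_le_add le_rfl (Finset.set_encard_biUnion_le _ _)))
      _ ≤ B.encard + ∑ T ∈ h𝒯.finite.toFinset, B.encard :=
          add_le_add le_rfl (Finset.sum_le_sum hT)
      _ = B.encard * (h𝒯.finite.toFinset.card + 1 : ℕ) := by
          rw [Finset.sum_const, nsmul_eq_mul, Nat.cast_add, Nat.cast_one, mul_add, _root_.mul_one,
            add_comm, mul_comm]
      _ ≤ _ := by
          rw [pow_succ, Nat.cast_mul]
          gcongr

theorem finite_stepBall (h𝒯 : 𝓖.IsGeneratingSet 𝒯) (n : ℕ) (x : X) : (𝓖.stepBall 𝒯 n x).Finite :=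
  finite_of_encard_le_coe (encard_stepBall_le h𝒯 n x)

theorem orbit_eq_iUnion_stepBall (h𝒯 : 𝓖.IsGeneratingSet 𝒯) (x : X) :
    𝓖.orbit x = ⋃ n, 𝓖.stepBall 𝒯 n x := by
  refine Subset.antisymm (fun y hy => ?_)
    (iUnion_subset fun n => stepBall_subset_orbit n (𝓖.mem_orbit_self x))
  obtain ⟨p, hp⟩ := (𝓖.orbitalGraph_connected h𝒯 x).exists_walk_length_eq_edist
    ⟨x, 𝓖.mem_orbit_self x⟩ ⟨y, hy⟩
  exact mem_iUnion.2 ⟨p.length, (mem_stepBall_iff h𝒯 p.length ⟨x, 𝓖.mem_orbit_self x⟩ ⟨y, hy⟩).2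
    hp.ge⟩

theorem countable_orbit (h𝒯 : 𝓖.IsGeneratingSet 𝒯) (x : X) : (𝓖.orbit x).Countable := by
  rw [orbit_eq_iUnion_stepBall h𝒯]
  exact countable_iUnion fun n => (finite_stepBall h𝒯 n x).countable

/-- Balls in an infinite orbit grow at least linearly: a ball which does not grow in one step is
the whole orbit. -/
theorem le_encard_stepBall (h𝒯 : 𝓖.IsGeneratingSet 𝒯) {x : X} (hx : (𝓖.orbit x).Infinite) (n : ℕ) :
    (n : ℕ∞) ≤ (𝓖.stepBall 𝒯 n x).encard := by
  induction n with
  | zero => simp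
  | succ n ih =>
    have hne : 𝓖.stepBall 𝒯 n x ≠ 𝓖.stepBall 𝒯 (n + 1) x := by
      intro he
      have hstab : ∀ m, 𝓖.stepBall 𝒯 m x ⊆ 𝓖.stepBall 𝒯 n x := by
        intro m
        induction m with
        | zero => exact stepBall_mono 𝒯 x (Nat.zero_le n)
        | succ m ihm =>
          rw [he]
          rintro z (hz | ⟨T, hT, γ, hγ, hs, hr⟩)
          · exact Or.inl (ihm hz)
          · exact Or.inr ⟨T, hT, γ, hγ, ihm hs, hr⟩
      refine hx ((finite_stepBall h𝒯 n x).subset ?_)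
      rw [orbit_eq_iUnion_stepBall h𝒯]
      exact iUnion_subset hstab
    have hlt := (finite_stepBall h𝒯 n x).encard_lt_encard
      ((stepBall_subset_succ 𝒯 n x).ssubset_of_ne hne)
    push_cast
    exact (add_le_add ih le_rfl).trans (Order.add_one_le_of_lt hlt)

/-- Balls are lower semicontinuous in their centre. -/
theorem exists_nhds_stepBall_inter_nonempty (h𝒯 : 𝓖.IsGeneratingSet 𝒯) (n : ℕ) {x z : X}
    (hz : z ∈ 𝓖.stepBall 𝒯 n x) {O : Set X} (hO : IsOpen O) (hzO : z ∈ O) :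
    ∃ W, IsOpen W ∧ x ∈ W ∧ ∀ y ∈ W, (𝓖.stepBall 𝒯 n y ∩ O).Nonempty := by
  induction n generalizing z O with
  | zero =>
    obtain rfl : z = x := hz
    exact ⟨O, hO, hzO, fun y hy => ⟨y, rfl, hy⟩⟩
  | succ n ih =>
    obtain hz | ⟨T, hT, γ, hγ, hs, rfl⟩ := hz
    · obtain ⟨W, hW, hxW, h⟩ := ih hz hO hzO
      exact ⟨W, hW, hxW, fun y hy => (h y hy).mono
        (inter_subset_inter_left _ (stepBall_subset_succ 𝒯 n y))⟩
    · have hO' : IsOpen (𝓖.src '' (T ∩ 𝓖.rng ⁻¹' O)) := 𝓖.isLocalHomeomorph_src.isOpenMap _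
        ((h𝒯.isBisection T hT).isOpen.inter (hO.preimage 𝓖.isLocalHomeomorph_rng.continuous))
      obtain ⟨W, hW, hxW, h⟩ := ih hs hO' ⟨γ, ⟨hγ, hzO⟩, rfl⟩
      refine ⟨W, hW, hxW, fun y hy => ?_⟩
      obtain ⟨_, h1, δ, ⟨hδ, hδO⟩, rfl⟩ := h y hy
      exact ⟨_, Or.inr ⟨T, hT, δ, hδ, h1, rfl⟩, hδO⟩

/-- By minimality, the uniform growth of every orbit is the orbital growth. -/
theorem IsMinimal.uniformGrowth_orbitalSpace_eq [T2Space X] (hmin : 𝓖.IsMinimal)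
    (h𝒯 : 𝓖.IsGeneratingSet 𝒯) (x : X) :
    uniformGrowth (𝓖.OrbitalSpace h𝒯 x) = 𝓖.orbitalGrowth 𝒯 := by
  funext n
  rw [uniformGrowth_orbitalSpace, orbitalGrowth_eq h𝒯]
  refine le_antisymm (iSup_le fun y => le_iSup (fun y => (𝓖.stepBall 𝒯 n y).encard) (y : X))
    (iSup_le fun y => ?_)
  have hfin := finite_stepBall h𝒯 n y
  obtain ⟨Q, hQ, hQd⟩ := hfin.t2_separation
  have := hfin.to_subtype
  choose W hW hyW hWQ using fun z : 𝓖.stepBall 𝒯 n y =>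
    exists_nhds_stepBall_inter_nonempty h𝒯 n z.2 (hQ z).2 (hQ z).1
  obtain ⟨y', hy', hy'x⟩ := (hmin x).inter_open_nonempty (⋂ z, W z) (isOpen_iInter_of_finite hW)
    ⟨y, mem_iInter.2 hyW⟩
  choose f hf using fun z => hWQ z y' (mem_iInter.1 hy' z)
  refine le_trans ?_ (le_iSup (fun y : 𝓖.orbit x => (𝓖.stepBall 𝒯 n y).encard) ⟨y', hy'x⟩)
  have hinj : Function.Injective f := by
    intro z z' h
    by_contra hne
    exact disjoint_left.1 (hQd z.2 z'.2 (Subtype.coe_injective.ne hne)) (hf z).2 (h ▸ (hf z').2)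
  calc (𝓖.stepBall 𝒯 n y).encard = (range f).encard := by
        rw [← image_univ, hinj.encard_image, encard_univ]; rfl
    _ ≤ _ := encard_le_encard (range_subset_iff.2 fun z => (hf z).1)

/-! ### The action of the full group on an orbit -/

theorem isBisection_listProd {l : List (Set 𝒢)} (h : ∀ T ∈ l, 𝓖.IsBisection T) :
    𝓖.IsBisection (𝓖.listProd l) := by
  induction l with
  | nil => exact 𝓖.isBisection_unitSet
  | cons T l ih =>
    exact (h T List.mem_cons_self).setMul (ih fun S hS => h S (List.mem_cons_of_mem _ hS))

theorem rng_mem_stepBall {l : List (Set 𝒢)} (h : ∀ T ∈ l, T ∈ 𝒯) {γ : 𝒢}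
    (hγ : γ ∈ 𝓖.listProd l) : 𝓖.rng γ ∈ 𝓖.stepBall 𝒯 l.length (𝓖.src γ) := by
  induction l generalizing γ with
  | nil =>
    obtain ⟨x, rfl⟩ := hγ
    rw [𝓖.src_one, 𝓖.rng_one]
    exact rfl
  | cons T l ih =>
    obtain ⟨⟨⟨α, β⟩, hc⟩, hα, hβ, rfl⟩ := hγ
    rw [𝓖.src_mul, 𝓖.rng_mul]
    exact Or.inr ⟨T, h T List.mem_cons_self, α, hα,
      by rw [hc]; exact ih (fun S hS => h S (List.mem_cons_of_mem _ hS)) hβ, rfl⟩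

theorem FullGroup.isCompact [CompactSpace X] (g : 𝓖.FullGroup) : IsCompact g.1 := by
  have := g.2.isBisection.isCompact_inter_preimage isCompact_univ g.2.src_image.ge
  rwa [preimage_univ, inter_univ] at this

theorem FullGroup.exists_smul_mem_stepBall [CompactSpace X] (h𝒯 : 𝓖.IsGeneratingSet 𝒯)
    (g : 𝓖.FullGroup) : ∃ n, ∀ x, g • x ∈ 𝓖.stepBall 𝒯 n x := by
  choose l hl hγl using h𝒯.generates
  obtain ⟨t, -, ht⟩ := g.isCompact.elim_nhds_subcover (fun γ => 𝓖.listProd (l γ)) fun γ _ =>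
    (isBisection_listProd fun T hT => h𝒯.isBisection T (hl γ T hT)).isOpen.mem_nhds (hγl γ)
  refine ⟨t.sup fun γ => (l γ).length, fun x => ?_⟩
  obtain ⟨γ, hγ, rfl, hr⟩ := g.exists_arrow x
  obtain ⟨δ, hδ, h⟩ := mem_iUnion₂.1 (ht hγ)
  rw [← hr]
  exact stepBall_mono 𝒯 _ (Finset.le_sup (f := fun γ => (l γ).length) hδ)
    (rng_mem_stepBall (hl δ) h)

noncomputable instance (h𝒯 : 𝓖.IsGeneratingSet 𝒯) (x : X) :
    MulAction 𝓖.FullGroup (𝓖.OrbitalSpace h𝒯 x) where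
  smul g y := ⟨g • y.toUnit, g.smul_mem_orbit (Subtype.prop (p := (· ∈ 𝓖.orbit x)) y)⟩
  one_smul y := Subtype.ext (one_smul _ y.toUnit)
  mul_smul g h y := Subtype.ext (mul_smul g h y.toUnit)

/-- The action of the full group on an orbit, by permutations of bounded displacement. -/
noncomputable def orbitHom [CompactSpace X] (h𝒯 : 𝓖.IsGeneratingSet 𝒯) (x : X) :
    𝓖.FullGroup →* wobblingGroup (𝓖.OrbitalSpace h𝒯 x) :=
  (MulAction.toPermHom 𝓖.FullGroup (𝓖.OrbitalSpace h𝒯 x)).codRestrict _ fun g => by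
    obtain ⟨n, hn⟩ := g.exists_smul_mem_stepBall h𝒯
    exact ⟨n, fun y => (dist_le_iff h𝒯 y (g • y) n).2 (hn y.toUnit)⟩

theorem IsMinimal.orbitHom_injective [T2Space X] [CompactSpace X] (hmin : 𝓖.IsMinimal)
    (heff : 𝓖.IsEffective) (h𝒯 : 𝓖.IsGeneratingSet 𝒯) (x : X) :
    Function.Injective (orbitHom h𝒯 x) := by
  intro g h hgh
  refine heff.fullGroup_ext fun y => ?_
  refine congrFun (Continuous.ext_on (hmin x) g.continuous_smul h.continuous_smul ?_) y
  intro z hz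
  have := congrArg (fun σ : wobblingGroup (𝓖.OrbitalSpace h𝒯 x) =>
    (σ.1 (⟨z, hz⟩ : 𝓖.orbit x)).toUnit) hgh
  exact this

/-! ### Existence of finite generating sets -/

theorem exists_isBisection_isCompact [T2Space X] [CompactSpace X] [TotallyDisconnectedSpace X]
    (𝓖 : EtaleGroupoid X 𝒢) (γ : 𝒢) : ∃ T, 𝓖.IsBisection T ∧ IsCompact T ∧ γ ∈ T := by
  obtain ⟨T, W, hT, -, -, h⟩ := 𝓖.exists_isFrame (ι := Unit) (x := 𝓖.src γ) (a := fun _ => γ)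
    (O := fun _ => univ) (fun _ => rfl) (fun _ _ _ => rfl) (fun _ => isOpen_univ)
    (fun _ => trivial)
  exact ⟨T (), hT.isBisection _, hT.isCompact _, (h ()).1⟩

theorem setInv_setInv (𝓖 : EtaleGroupoid X 𝒢) (T : Set 𝒢) : 𝓖.setInv (𝓖.setInv T) = T := by
  simp [setInv, image_image, 𝓖.inv_inv]

theorem IsCompactlyGenerated.exists_isGeneratingSet [T2Space X] [CompactSpace X]
    [TotallyDisconnectedSpace X] (hcg : 𝓖.IsCompactlyGenerated) :
    ∃ 𝒯 : Set (Set 𝒢), 𝓖.IsGeneratingSet 𝒯 := by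
  obtain ⟨K, hK, hgen⟩ := hcg
  choose V hV hVc hγV using 𝓖.exists_isBisection_isCompact
  obtain ⟨t, -, ht⟩ := hK.elim_nhds_subcover V fun γ _ => (hV γ).isOpen.mem_nhds (hγV γ)
  refine ⟨V '' t ∪ 𝓖.setInv '' (V '' t), (t.finite_toSet.image V).union
    ((t.finite_toSet.image V).image _), ?_, ?_, ?_, ?_⟩
  · rintro _ (⟨γ, -, rfl⟩ | ⟨_, ⟨γ, -, rfl⟩, rfl⟩)
    exacts [hV γ, (hV γ).setInv]
  · rintro _ (⟨γ, -, rfl⟩ | ⟨_, ⟨γ, -, rfl⟩, rfl⟩)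
    exacts [hVc γ, (hVc γ).image 𝓖.continuous_inv]
  · rintro _ (h | ⟨T, h, rfl⟩)
    · exact Or.inr ⟨_, h, rfl⟩
    · rw [𝓖.setInv_setInv]
      exact Or.inl h
  · have key : ∀ l : List (Set 𝒢), (∀ T ∈ l, T ∈ ({K, 𝓖.setInv K} : Set (Set 𝒢))) →
        ∀ γ ∈ 𝓖.listProd l, ∃ l' : List (Set 𝒢),
          (∀ T ∈ l', T ∈ V '' t ∪ 𝓖.setInv '' (V '' t)) ∧ γ ∈ 𝓖.listProd l' := by
      intro l
      induction l with
      | nil => exact fun _ γ hγ => ⟨[], by simp, hγ⟩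
      | cons T l ih =>
        rintro hl _ ⟨⟨⟨α, β⟩, hc⟩, hα, hβ, rfl⟩
        obtain ⟨l', hl', hβ'⟩ := ih (fun S hS => hl S (List.mem_cons_of_mem _ hS)) β hβ
        obtain ⟨S, hS, hαS⟩ : ∃ S ∈ V '' t ∪ 𝓖.setInv '' (V '' t), α ∈ S := by
          have hT : T = K ∨ T = 𝓖.setInv K := hl T List.mem_cons_self
          rcases hT with rfl | rfl
          · obtain ⟨δ, hδ, h⟩ := mem_iUnion₂.1 (ht hα)
            exact ⟨V δ, Or.inl ⟨δ, hδ, rfl⟩, h⟩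
          · obtain ⟨α', hα', rfl⟩ := hα
            obtain ⟨δ, hδ, h⟩ := mem_iUnion₂.1 (ht hα')
            exact ⟨_, Or.inr ⟨_, ⟨δ, hδ, rfl⟩, rfl⟩, ⟨α', h, rfl⟩⟩
        exact ⟨S :: l', List.forall_mem_cons.2 ⟨hS, hl'⟩, ⟨⟨(α, β), hc⟩, hαS, hβ', rfl⟩⟩
    intro γ
    obtain ⟨l, hl, hγ⟩ := hgen γ
    exact key l hl γ hγ

end EtaleGroupoid

/-! ### Isometric copies -/

theorem uniformGrowth_congr {Γ : Type*} {Γ' : Type*} [MetricSpace Γ] [MetricSpace Γ']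
    (e : Γ ≃ᵢ Γ') : uniformGrowth Γ' = uniformGrowth Γ := by
  funext n
  refine (e.toEquiv.iSup_congr fun v => ?_).symm
  rw [← e.injective.encard_image (Metric.closedBall v n), e.image_closedBall]
  rfl

/-- Conjugation by an isometry identifies the wobbling groups. -/
noncomputable def wobblingGroupCongr {Γ : Type*} {Γ' : Type*} [MetricSpace Γ] [MetricSpace Γ']
    (e : Γ ≃ᵢ Γ') : wobblingGroup Γ →* wobblingGroup Γ' :=
  (e.toEquiv.permCongrHom.toMonoidHom.comp (wobblingGroup Γ).subtype).codRestrict _ fun σ => by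
    obtain ⟨C, hC⟩ := σ.2
    refine ⟨C, fun v => ?_⟩
    have := hC (e.symm v)
    rw [← e.dist_eq, e.apply_symm_apply] at this
    exact this

theorem wobblingGroupCongr_injective {Γ : Type*} {Γ' : Type*} [MetricSpace Γ] [MetricSpace Γ']
    (e : Γ ≃ᵢ Γ') : Function.Injective (wobblingGroupCongr e) := fun _ _ h =>
  Subtype.ext (e.toEquiv.permCongrHom.injective (congrArg Subtype.val h))

theorem GrowthLE.refl (f : ℕ → ℕ∞) : GrowthLE f f := ⟨1, one_pos, fun n => by simp⟩

namespace EtaleGroupoid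

variable {X : Type u} {𝒢 : Type v} [TopologicalSpace X] [TopologicalSpace 𝒢]
  {𝓖 : EtaleGroupoid X 𝒢} {𝒯 : Set (Set 𝒢)}

/-! ### Sharpness of the orbital growth -/

theorem IsMinimal.infinite_alternatingFullGroup [T2Space X] [CompactSpace X]
    [TotallyDisconnectedSpace X] [PerfectSpace X] (hmin : 𝓖.IsMinimal) (x : X) :
    Infinite 𝓖.alternatingFullGroup := by
  have := (hmin.infinite_orbit x).to_subtype
  choose g hg hgx using fun y : 𝓖.orbit x => hmin.exists_smul_eq y.2
  refine Infinite.of_injective (fun y => (⟨g y, hg y⟩ : 𝓖.alternatingFullGroup)) fun y z h => ?_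
  rw [Subtype.ext_iff, ← hgx y, ← hgx z]
  exact congrArg (fun a : 𝓖.alternatingFullGroup => (a : 𝓖.FullGroup) • x) h

/-- The faithful action on a copy of an orbit limits the functions for which the alternating full
group has the property `FG_f`. -/
theorem IsMinimal.growthLE_of_hasPropertyFG [T2Space X] [CompactSpace X]
    [TotallyDisconnectedSpace X] [PerfectSpace X] (hmin : 𝓖.IsMinimal) (heff : 𝓖.IsEffective)
    (h𝒯 : 𝓖.IsGeneratingSet 𝒯) (x : X) (hbg : BoundedGeometry (𝓖.OrbitalSpace h𝒯 x))
    {f : ℕ → ℕ∞} (hf : HasPropertyFG.{v, w} 𝓖.alternatingFullGroup f) :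
    GrowthLE f (𝓖.orbitalGrowth 𝒯) := by
  have : Countable (𝓖.OrbitalSpace h𝒯 x) := (countable_orbit h𝒯 x).to_subtype
  let e₀ := (equivShrink.{w} (𝓖.OrbitalSpace h𝒯 x)).symm
  let _ : MetricSpace (Shrink.{w} (𝓖.OrbitalSpace h𝒯 x)) :=
    MetricSpace.induced e₀ e₀.injective inferInstance
  let e := (IsometryEquiv.mk e₀ (Isometry.of_dist_eq fun _ _ => rfl)).symm
  have he := uniformGrowth_congr e
  by_contra hnot
  rw [← hmin.uniformGrowth_orbitalSpace_eq h𝒯 x, ← he] at hnot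
  let ρ := ((wobblingGroupCongr e).comp (orbitHom h𝒯 x)).comp 𝓖.alternatingFullGroup.subtype
  have hρ : Function.Injective ρ := ((wobblingGroupCongr_injective e).comp
    (hmin.orbitHom_injective heff h𝒯 x)).comp Subtype.val_injective
  have := hmin.infinite_alternatingFullGroup x
  refine (infinite_range_of_injective hρ) ?_
  rw [← MonoidHom.coe_range]
  exact hf _ (fun n => he ▸ hbg n) hnot ρ

end EtaleGroupoid

theorem mainTheorem4 {X : Type u} {𝒢 : Type v} [TopologicalSpace X] [TopologicalSpace 𝒢]
    (hX : Nonempty (X ≃ₜ (ℕ → Bool))) (𝓖 : EtaleGroupoid X 𝒢)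
    (hmin : 𝓖.IsMinimal) (heff : 𝓖.IsEffective) (hcg : 𝓖.IsCompactlyGenerated) :
    -- the orbital growth is defined: there are finite generating sets of compact open bisections
    (∃ 𝒯 : Set (Set 𝒢), 𝓖.IsGeneratingSet 𝒯) ∧
    ∀ (𝒯 : Set (Set 𝒢)) (h𝒯 : 𝓖.IsGeneratingSet 𝒯),
      -- the orbital growth lies in the range of functions for which the property is defined
      GrowthLE (fun n => (n : ℕ∞)) (𝓖.orbitalGrowth 𝒯) ∧
      GrowthLE (𝓖.orbitalGrowth 𝒯) (fun n => ((⌈Real.exp n⌉₊ : ℕ) : ℕ∞)) ∧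
      -- the property, and the triviality of homomorphisms
      HasPropertyFG.{v, w} 𝓖.alternatingFullGroup (𝓖.orbitalGrowth 𝒯) ∧
      (∀ (Γ : Type w) [MetricSpace Γ], BoundedGeometry Γ →
        ¬ GrowthLE (𝓖.orbitalGrowth 𝒯) (uniformGrowth Γ) →
        ∀ ρ : 𝓖.alternatingFullGroup →* wobblingGroup Γ, ρ = 1) ∧
      -- sharpness: the natural action on each orbit is a faithful action by permutations of bounded
      -- displacement, on a space whose uniform growth is equivalent to the orbital growth
      (∀ x : X, BoundedGeometry (𝓖.OrbitalSpace h𝒯 x) ∧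
        GrowthLE (uniformGrowth (𝓖.OrbitalSpace h𝒯 x)) (𝓖.orbitalGrowth 𝒯) ∧
        GrowthLE (𝓖.orbitalGrowth 𝒯) (uniformGrowth (𝓖.OrbitalSpace h𝒯 x)) ∧
        ∃ φ : 𝓖.FullGroup →* wobblingGroup (𝓖.OrbitalSpace h𝒯 x), Function.Injective φ ∧
          ∀ (g : 𝓖.FullGroup) (y : 𝓖.OrbitalSpace h𝒯 x),
            ∃ γ ∈ g.1, 𝓖.src γ = y.toUnit ∧ 𝓖.rng γ = ((φ g).1 y).toUnit) ∧
      -- sharpness: no larger function will do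
      (∀ f : ℕ → ℕ∞, HasPropertyFG.{v, w} 𝓖.alternatingFullGroup f →
        GrowthLE f (𝓖.orbitalGrowth 𝒯)) := by
  obtain ⟨e⟩ := hX
  have : T2Space X := e.symm.t2Space
  have : CompactSpace X := e.symm.compactSpace
  have : TotallyDisconnectedSpace X := e.symm.totallyDisconnectedSpace
  have : PerfectSpace X := perfectSpace_of_homeomorph e
  obtain ⟨x₀⟩ : Nonempty X := ⟨e.symm fun _ => false⟩
  refine ⟨hcg.exists_isGeneratingSet, fun 𝒯 h𝒯 => ?_⟩
  have hle : ∀ n, 𝓖.orbitalGrowth 𝒯 n ≤ (((h𝒯.finite.toFinset.card + 1) ^ n : ℕ) : ℕ∞) := by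
    intro n
    rw [EtaleGroupoid.orbitalGrowth_eq h𝒯]
    exact iSup_le fun x => EtaleGroupoid.encard_stepBall_le h𝒯 n x
  have hbg : ∀ x, BoundedGeometry (𝓖.OrbitalSpace h𝒯 x) := by
    intro x n
    rw [hmin.uniformGrowth_orbitalSpace_eq]
    exact (hle n).trans_lt (ENat.natCast_lt_top _)
  have htriv : ∀ (Γ : Type w) [MetricSpace Γ], BoundedGeometry Γ →
      ¬ GrowthLE (𝓖.orbitalGrowth 𝒯) (uniformGrowth Γ) →
      ∀ ρ : 𝓖.alternatingFullGroup →* wobblingGroup Γ, ρ = 1 := by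
    intro Γ _ hΓ hgrowth ρ
    rw [EtaleGroupoid.orbitalGrowth_eq h𝒯] at hgrowth
    exact hmin.eq_one_of_not_growthLE heff h𝒯 hΓ hgrowth ρ
  refine ⟨⟨1, one_pos, fun n => ?_⟩, ⟨h𝒯.finite.toFinset.card + 1, by omega, fun n => ?_⟩, ?_,
    htriv, fun x => ⟨hbg x, ?_, ?_, EtaleGroupoid.orbitHom h𝒯 x,
      hmin.orbitHom_injective heff h𝒯 x, ?_⟩,
    fun f hf => hmin.growthLE_of_hasPropertyFG heff h𝒯 x₀ (hbg x₀) hf⟩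
  · rw [Nat.cast_one, _root_.one_mul, _root_.one_mul, EtaleGroupoid.orbitalGrowth_eq h𝒯]
    exact (EtaleGroupoid.le_encard_stepBall h𝒯 (hmin.infinite_orbit x₀) n).trans
      (le_iSup (fun x => (𝓖.stepBall 𝒯 n x).encard) x₀)
  · refine (hle n).trans ?_
    rw [← Nat.cast_mul, Nat.cast_le]
    set k := h𝒯.finite.toFinset.card + 1
    have h1 : ((k ^ n : ℕ) : ℝ) ≤ Real.exp ((k * n : ℕ) : ℝ) := by
      push_cast
      rw [mul_comm, Real.exp_nat_mul]
      gcongr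
      linarith [Real.add_one_le_exp (k : ℝ)]
    have h2 : k ^ n ≤ ⌈Real.exp ((k * n : ℕ) : ℝ)⌉₊ := by
      exact_mod_cast h1.trans (Nat.le_ceil _)
    exact h2.trans (Nat.le_mul_of_pos_left _ (by omega))
  · intro Γ _ hΓ hgrowth ρ
    rw [htriv Γ hΓ hgrowth ρ, MonoidHom.range_one]
    exact finite_singleton 1
  · rw [hmin.uniformGrowth_orbitalSpace_eq]
    exact GrowthLE.refl _
  · rw [hmin.uniformGrowth_orbitalSpace_eq]
    exact GrowthLE.refl _
  · intro g y
    exact g.exists_arrow y.toUnit
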